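/- **Setting.** Let $D_1,D_2,\dots$ be i.i.d. with law $P_D$ on a measurable space $\mathcal D$, let $\Theta\subset\mathbb R^d$, let $\Xi$ be a real vector space with a (semi)norm, for instance $\|\cdot\|_{P,2}$, and let $g:\mathcal D\times\Theta\times\Xi\to\mathbb R^L$ be a moment function. Let $\xi_0:\theta\mapsto\xi_0(\theta)\in\Xi$ be the true nuisance function and let $\Theta_I=\{\theta\in\Theta:\mathbb E\,g(D,\theta,\xi_0(\theta))\le 0\}$ (coordinatewise), assumed non-empty. Write $\|x\|_+=\|\max(x,0)\|$. The indices $\{1,\dots,N\}$ are split at random, independently of the data, into a fixed number $\mathcal K$ of folds $J_1,\dots,J_{\mathcal K}$ of equal size (up to one element if $\mathcal K\nmid N$). For $i\in J_k$ let $\widehat\xi_i(\cdot)=\widehat\xi\big((D_j)_{j\notin J_k}\big)(\cdot)$ be an estimator of $\xi_0(\cdot)$ computed from the data outside $J_k$. Put $$Q_N(\theta,\widehat\xi)=\Big\|\tfrac1N\sum_{i=1}^N g(D_i,\theta,\widehat\xi_i(\theta))\Big\|_+^2,\qquad \widehat\Theta_I=\{\theta\in\Theta: N Q_N(\theta,\widehat\xi)\le\widehat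 c\}$$ for a possibly data-dependent level $\widehat c$. The Hausdorff distance is $d_H(A,B)=\max\{\sup_{a\in A}d(a,B),\sup_{b\in B}d(b,A)\}$, and it is $\infty$ if exactly one of the sets is empty. **Assumptions.** 1. *Partial identification.* There are $C,\delta>0$ with $\|\mathbb E\,g(D,\theta,\xi_0(\theta))\|_+\ge (C\,d(\theta,\Theta_I))\wedge\delta$ for all $\theta\in\Theta$. 2. *Orthogonality.* There are convex sets $\Xi^\theta\subset\Xi$ and, for each $N\ge1$, a set $\Xi_N$ of functions $\xi(\cdot)$ with $\xi(\theta)\in\Xi^\theta$ for $\theta\in\Theta$, such that $\xi_0\in\Xi_N$ and: - for each fold, the first-stage estimate lies in $\Xi_N$ with probability at least $1-\phi_N$, where $\phi_N=o(1)$; - $\sup_{\theta\in\Theta,\,\xi\in\Xi_N}\|\xi(\theta)-\xi_0(\theta)\|\le g_N=o(N^{-1/4})$; - for all $\theta\in\Theta$, $\xi\in\Xi_N$ the path $r\mapsto\mathbb E\,g(D,\theta,r(\xi(\theta)-\xi_0(\theta))+\xi_0(\theta))$ is well defined and continuous on $[0,1]$ and twice differentiable on $[0,1)$, its first derivative vanishes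 at $r=0$ (Neyman orthogonality), and its second derivative is bounded on $[0,1)$ by $s_N=o(N^{-1/2})$, uniformly in $\theta$ and $\xi$. 3. *Regularity.* There are constants $c>2$, $c_1$, $a$, $v$ such that for all $N\geq 1$ and $\xi\in\Xi_N$ the class $\mathcal F_\xi=\{g_l(\cdot,\theta,\xi(\theta)):\theta\in\Theta,\,l\le L\}$ has a measurable envelope $F_\xi$ with $\|F_\xi\|_{P,c}\le c_1$ that satisfies, for all $0<\epsilon\le1$, $$\sup_Q\log N(\epsilon\|F_\xi\|_{Q,2},\mathcal F_\xi,\|\cdot\|_{Q,2})\le v\log(a/\epsilon),$$ the supremum being over finitely discrete probability measures $Q$ with $\|F_\xi\|_{Q,2}>0$. Moreover $\sup_{\theta\in\Theta,\,\xi\in\Xi_N}(\mathbb E\|g(D,\theta,\xi(\theta))-g(D,\theta,\xi_0(\theta))\|^2)^{1/2}\le r_N'$, where $r'_N\geq 0$ and $r_N'\log(1/r_N')=o(1)$. The moments $g(\cdot,\theta,\xi(\theta))$, $\xi\in\Xi_N$, and the estimated moments are measurable, and the classes $\mathcal F_\xi$, $\xi\in\Xi_N$, are pointwise measurable along a common countable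 subset of $\Theta$. 4. *Donsker property.* On an open set $\Theta'\supset\Theta$ the process $\sqrt N\big(\tfrac1N\sum_{i\le N} g(D_i,\theta,\xi_0(\theta))-\mathbb E\,g(D,\theta,\xi_0(\theta))\big)$ converges weakly in $L^\infty(\Theta')$ to a tight mean-zero Gaussian process $\Delta$, defined on the same probability space, with a.s. continuous paths and $\operatorname{Var}(\Delta_l(\theta))>0$ for all $\theta\in\Theta'$ and $l\le L$. 5. *Contour level.* With probability tending to one, $\widehat c\ge\sup_{\theta\in\Theta_I}N Q_N(\theta,\widehat\xi)$ (equivalently, $\Theta_I\subset\widehat\Theta_I$). Moreover, $\Theta$ is bounded or $\widehat c/N\to0$ in probability. **Conclusion.** $d_H(\widehat\Theta_I,\Theta_I)=O_P\big(\sqrt{(1\vee\widehat c)/N}\big)$: for every $\varepsilon>0$ there is $M>0$ such that $\Pr\big(d_H(\widehat\Theta_I,\Theta_I)>M\sqrt{(1\vee\widehat c)/N}\big)\le\varepsilon$ for all sufficiently large $N$. (Probabilities of possibly non-measurable events are outer probabilities.) -/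

import Mathlib

open MeasureTheory ProbabilityTheory Filter Topology Asymptotics
open scoped ENNReal NNReal BoundedContinuousFunction

noncomputable section

/-! ### The moment problem -/

/-- The Euclidean space `ℝⁿ`. -/
abbrev Rn (n : ℕ) : Type := EuclideanSpace ℝ (Fin n)

/-- `‖x‖₊ = ‖max(x, 0)‖`, the maximum being taken coordinatewise. -/
def plusNorm {L : ℕ} (x : Rn L) : ℝ :=
  ‖(WithLp.toLp 2 (fun l => max (x l) 0) : Rn L)‖

/-- The population moment `E g(D, θ, ξ(θ))` at a nuisance function `ξ(·)`, with `D ~ PD`. -/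
def popMoment {𝒟 Ξ : Type*} [MeasurableSpace 𝒟] {d L : ℕ} (PD : Measure 𝒟)
    (g : 𝒟 → Rn d → Ξ → Rn L) (ξ : Rn d → Ξ) (θ : Rn d) : Rn L :=
  ∫ x, g x θ (ξ θ) ∂PD

/-- The identified set `Θ_I = {θ ∈ Θ : E g(D, θ, ξ₀(θ)) ≤ 0}`. -/
def identifiedSet {𝒟 Ξ : Type*} [MeasurableSpace 𝒟] {d L : ℕ} (PD : Measure 𝒟)
    (g : 𝒟 → Rn d → Ξ → Rn L) (ξ₀ : Rn d → Ξ) (Θ : Set (Rn d)) : Set (Rn d) :=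
  {θ ∈ Θ | ∀ l, popMoment PD g ξ₀ θ l ≤ 0}

/-- Partial identification: `‖E g(D, θ, ξ₀)‖₊ ≥ C d(θ, Θ_I) ∧ δ` on `Θ`, with `C, δ > 0`. -/
def PartialIdentification {𝒟 Ξ : Type*} [MeasurableSpace 𝒟] {d L : ℕ} (PD : Measure 𝒟)
    (g : 𝒟 → Rn d → Ξ → Rn L) (ξ₀ : Rn d → Ξ) (Θ : Set (Rn d)) : Prop :=
  ∃ C > 0, ∃ δ > 0, ∀ θ ∈ Θ,
    min (C * Metric.infDist θ (identifiedSet PD g ξ₀ Θ)) δ ≤ plusNorm (popMoment PD g ξ₀ θ)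

/-! ### Cross-fitting and the contour-set estimator -/

/-- The indices `i < N` outside of fold `k`, for the fold assignment `κ`. -/
def trainSet {K : ℕ} (N : ℕ) (κ : ℕ → Fin K) (k : Fin K) : Finset ℕ :=
  (Finset.range N).filter (fun i => κ i ≠ k)

/-- `fold N ω` assigns a fold to each index `i < N`.  The partition is random, drawn independently
of the data, and its folds have equal size (up to one element when `K` does not divide `N`). -/
structure IsRandomPartition {Ω 𝒟 : Type*} [MeasurableSpace Ω] [MeasurableSpace 𝒟] {K : ℕ}
    (P : Measure Ω) (D : ℕ → Ω → 𝒟) (fold : ℕ → Ω → ℕ → Fin K) : Prop where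
  measurable : ∀ N, Measurable (fold N)
  indep : ∀ N, IndepFun (fold N) (fun ω i => D i ω) P
  balanced : ∀ N ω k,
    N / K ≤ ((Finset.range N).filter (fun i => fold N ω i = k)).card ∧
      ((Finset.range N).filter (fun i => fold N ω i = k)).card ≤ N / K + 1

/-- The first-stage estimate `ξ̂(·)` used on fold `k`: the estimator `est` applied to the
observations outside of fold `k`. -/
def foldEstimate {Ω 𝒟 Ξ : Type*} {d K : ℕ}
    (est : (N : ℕ) → (J : Finset ℕ) → (J → 𝒟) → Rn d → Ξ)
    (D : ℕ → Ω → 𝒟) (fold : ℕ → Ω → ℕ → Fin K) (N : ℕ) (k : Fin K) (ω : Ω) : Rn d → Ξ :=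
  est N (trainSet N (fold N ω) k) (fun i => D i ω)

/-- The sample criterion `Q_N(θ, ξ̂) = ‖N⁻¹ ∑_{i < N} g(D_i, θ, ξ̂_i(θ))‖₊²`, where `ξ̂_i` is the
estimate used on the fold containing `i`. -/
def sampleCriterion {Ω 𝒟 Ξ : Type*} {d L K : ℕ}
    (g : 𝒟 → Rn d → Ξ → Rn L)
    (est : (N : ℕ) → (J : Finset ℕ) → (J → 𝒟) → Rn d → Ξ)
    (D : ℕ → Ω → 𝒟) (fold : ℕ → Ω → ℕ → Fin K) (N : ℕ) (ω : Ω) (θ : Rn d) : ℝ :=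
  plusNorm ((N : ℝ)⁻¹ • ∑ i ∈ Finset.range N,
    g (D i ω) θ (foldEstimate est D fold N (fold N ω i) ω θ)) ^ 2

/-- The contour set `{θ ∈ Θ : N Q_N(θ, ξ̂) ≤ c}`. -/
def contourSet {Ω 𝒟 Ξ : Type*} {d L K : ℕ}
    (g : 𝒟 → Rn d → Ξ → Rn L) (Θ : Set (Rn d))
    (est : (N : ℕ) → (J : Finset ℕ) → (J → 𝒟) → Rn d → Ξ)
    (D : ℕ → Ω → 𝒟) (fold : ℕ → Ω → ℕ → Fin K) (N : ℕ) (ω : Ω) (c : ℝ) : Set (Rn d) :=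
  {θ ∈ Θ | (N : ℝ) * sampleCriterion g est D fold N ω θ ≤ c}

/-! ### Neyman orthogonality and first-stage rates -/

/-- The path `r ↦ E g(D, θ, r(ξ(θ) - ξ₀(θ)) + ξ₀(θ))`. -/
def momentPath {𝒟 Ξ : Type*} [MeasurableSpace 𝒟] [AddCommGroup Ξ] [Module ℝ Ξ] {d L : ℕ}
    (PD : Measure 𝒟) (g : 𝒟 → Rn d → Ξ → Rn L) (ξ₀ ξ : Rn d → Ξ) (θ : Rn d) (r : ℝ) : Rn L :=
  ∫ x, g x θ (r • (ξ θ - ξ₀ θ) + ξ₀ θ) ∂PD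

/-- Neyman orthogonality at `ξ₀` with respect to a set `S` of nuisance functions: the path of
moments is well defined and continuous on `[0, 1]`, its derivative exists on `[0, 1)`, and that
derivative vanishes at `r = 0`, for every `θ ∈ Θ`. -/
def NeymanOrthogonal {𝒟 Ξ : Type*} [MeasurableSpace 𝒟] [AddCommGroup Ξ] [Module ℝ Ξ] {d L : ℕ}
    (PD : Measure 𝒟) (g : 𝒟 → Rn d → Ξ → Rn L) (ξ₀ : Rn d → Ξ) (Θ : Set (Rn d))
    (S : Set (Rn d → Ξ)) : Prop :=
  ∀ ξ ∈ S, ∀ θ ∈ Θ,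
    (∀ r ∈ Set.Icc (0 : ℝ) 1, Integrable (fun x => g x θ (r • (ξ θ - ξ₀ θ) + ξ₀ θ)) PD) ∧
    ContinuousOn (momentPath PD g ξ₀ ξ θ) (Set.Icc 0 1) ∧
    DifferentiableOn ℝ (momentPath PD g ξ₀ ξ θ) (Set.Ico 0 1) ∧
    derivWithin (momentPath PD g ξ₀ ξ θ) (Set.Ico 0 1) 0 = 0

/-- The second derivative along the path exists on `[0, 1)` and is bounded there by `s`, for every
`ξ ∈ S` and `θ ∈ Θ`. -/
def SecondGateauxBound {𝒟 Ξ : Type*} [MeasurableSpace 𝒟] [AddCommGroup Ξ] [Module ℝ Ξ] {d L : ℕ}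
    (PD : Measure 𝒟) (g : 𝒟 → Rn d → Ξ → Rn L) (ξ₀ : Rn d → Ξ) (Θ : Set (Rn d))
    (S : Set (Rn d → Ξ)) (s : ℝ) : Prop :=
  ∀ ξ ∈ S, ∀ θ ∈ Θ,
    DifferentiableOn ℝ (derivWithin (momentPath PD g ξ₀ ξ θ) (Set.Ico 0 1)) (Set.Ico 0 1) ∧
    ∀ r ∈ Set.Ico (0 : ℝ) 1,
      ‖derivWithin (derivWithin (momentPath PD g ξ₀ ξ θ) (Set.Ico 0 1)) (Set.Ico 0 1) r‖ ≤ s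

/-- The orthogonality condition, for a sequence `ΞN` of sets of nuisance functions `θ ↦ ξ(θ)`
(a product `⨯_θ Ξ_N^θ` is the special case `{ξ | ∀ θ ∈ Θ, ξ θ ∈ Ξ_N^θ}`), all of them with values
in the convex sets `ΞΘ θ`.  The norm of `Ξ` is the one in which the first-stage rate is measured,
for instance the norm or the seminorm of `L²(PD)`. -/
structure OrthogonalityCondition {Ω 𝒟 Ξ : Type*} [MeasurableSpace Ω] [MeasurableSpace 𝒟]
    [SeminormedAddCommGroup Ξ] [NormedSpace ℝ Ξ] {d L K : ℕ}
    (P : Measure Ω) (PD : Measure 𝒟) (g : 𝒟 → Rn d → Ξ → Rn L) (ξ₀ : Rn d → Ξ) (Θ : Set (Rn d))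
    (ΞΘ : Rn d → Set Ξ) (ΞN : ℕ → Set (Rn d → Ξ))
    (est : (N : ℕ) → (J : Finset ℕ) → (J → 𝒟) → Rn d → Ξ)
    (D : ℕ → Ω → 𝒟) (fold : ℕ → Ω → ℕ → Fin K) : Prop where
  convex : ∀ θ ∈ Θ, Convex ℝ (ΞΘ θ)
  subset : ∀ N ≥ 1, ∀ ξ ∈ ΞN N, ∀ θ ∈ Θ, ξ θ ∈ ΞΘ θ
  true_mem : ∀ N ≥ 1, ξ₀ ∈ ΞN N
  /-- with probability at least `1 - φ_N`, `φ_N = o(1)`, the first-stage estimate is in `ΞN N` -/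
  estimate_mem : ∃ φ : ℕ → ℝ, Tendsto φ atTop (𝓝 0) ∧ ∀ N ≥ 1, ∀ k : Fin K,
    P {ω | foldEstimate est D fold N k ω ∉ ΞN N} ≤ ENNReal.ofReal (φ N)
  /-- the first-stage rate is `g_N = o(N^{-1/4})`, uniformly over `Θ` -/
  rate : ∃ gN : ℕ → ℝ, gN =o[atTop] (fun N : ℕ => (N : ℝ) ^ (-(1 / 4) : ℝ)) ∧
    ∀ N ≥ 1, ∀ ξ ∈ ΞN N, ∀ θ ∈ Θ, ‖ξ θ - ξ₀ θ‖ ≤ gN N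
  orthogonal : ∀ N ≥ 1, NeymanOrthogonal PD g ξ₀ Θ (ΞN N)
  /-- the second Gateaux derivative is bounded by `s_N = o(N^{-1/2})` -/
  second_deriv : ∃ s : ℕ → ℝ, s =o[atTop] (fun N : ℕ => (N : ℝ) ^ (-(1 / 2) : ℝ)) ∧
    ∀ N ≥ 1, SecondGateauxBound PD g ξ₀ Θ (ΞN N) (s N)

/-! ### Regularity of the moment function -/

/-- The scalar class `𝓕_ξ = {g_l(·, θ, ξ(θ)) : θ ∈ Θ, l ≤ L}`. -/
def momentClass {𝒟 Ξ : Type*} {d L : ℕ} (g : 𝒟 → Rn d → Ξ → Rn L) (Θ : Set (Rn d))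
    (ξ : Rn d → Ξ) : Set (𝒟 → ℝ) :=
  {f | ∃ θ ∈ Θ, ∃ l, f = fun x => g x θ (ξ θ) l}

/-- The image of `f` in `L²(Q)`, where `Q = ∑ i, w i δ_{x i}` is a finitely discrete measure;
the Euclidean norm of this vector is `‖f‖_{Q,2}`. -/
def discreteL2 {𝒟 : Type*} {m : ℕ} (w : Fin m → ℝ) (x : Fin m → 𝒟) (f : 𝒟 → ℝ) : Rn m :=
  WithLp.toLp 2 (fun i => √(w i) * f (x i))

/-- The uniform covering entropy bound
`sup_Q log N(ε ‖F‖_{Q,2}, 𝓕, ‖·‖_{Q,2}) ≤ v log (a / ε)` for `0 < ε ≤ 1`, the supremum being over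
the finitely discrete probability measures `Q` with `‖F‖_{Q,2} > 0`. -/
def UniformEntropyBound {𝒟 : Type*} (𝓕 : Set (𝒟 → ℝ)) (F : 𝒟 → ℝ) (a v : ℝ) : Prop :=
  ∀ (m : ℕ) (w : Fin m → ℝ) (x : Fin m → 𝒟), (∀ i, 0 < w i) → ∑ i, w i = 1 →
    0 < ‖discreteL2 w x F‖ → ∀ ε : ℝ, 0 < ε → ε ≤ 1 →
      Metric.externalCoveringNumber (Real.toNNReal (ε * ‖discreteL2 w x F‖))
          (discreteL2 w x '' 𝓕) ≠ ⊤ ∧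
        Real.log ((Metric.externalCoveringNumber (Real.toNNReal (ε * ‖discreteL2 w x F‖))
          (discreteL2 w x '' 𝓕)).toNat : ℝ) ≤ v * Real.log (a / ε)

/-- Regularity of the moment function.  The constants `c > 2`, `c₁`, `a`, `v` do not depend on `N`
or on `ξ ∈ ΞN N`. -/
structure RegularityCondition {𝒟 Ξ : Type*} [MeasurableSpace 𝒟] {d L : ℕ}
    (PD : Measure 𝒟) (g : 𝒟 → Rn d → Ξ → Rn L) (ξ₀ : Rn d → Ξ) (Θ : Set (Rn d))
    (ΞN : ℕ → Set (Rn d → Ξ)) : Prop where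
  /-- an envelope with a bounded `L^c` norm, and bounded uniform covering entropy -/
  envelope_entropy : ∃ c > (2 : ℝ), ∃ c₁ a v : ℝ, ∀ N ≥ 1, ∀ ξ ∈ ΞN N,
    ∃ F : 𝒟 → ℝ, Measurable F ∧ (∀ᵐ x ∂PD, ∀ θ ∈ Θ, ∀ l, |g x θ (ξ θ) l| ≤ F x) ∧
      eLpNorm F (ENNReal.ofReal c) PD ≤ ENNReal.ofReal c₁ ∧
      UniformEntropyBound (momentClass g Θ ξ) F a v
  /-- mean-square continuity at `ξ₀`, at a rate `r'_N` with `r'_N log (1 / r'_N) = o(1)` -/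
  mean_square : ∃ r : ℕ → ℝ, (∀ N, 0 ≤ r N) ∧
    Tendsto (fun N => r N * Real.log (1 / r N)) atTop (𝓝 0) ∧
    ∀ N ≥ 1, ∀ ξ ∈ ΞN N, ∀ θ ∈ Θ,
      eLpNorm (fun x => g x θ (ξ θ) - g x θ (ξ₀ θ)) 2 PD ≤ ENNReal.ofReal (r N)

/-- Measurability of the moment functions and of the estimated moments, and pointwise measurability
of the classes `𝓕_ξ` (suprema over `Θ` can be computed along a countable subset). -/
structure SuitablyMeasurable {𝒟 Ξ : Type*} [MeasurableSpace 𝒟] {d L : ℕ}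
    (g : 𝒟 → Rn d → Ξ → Rn L) (Θ : Set (Rn d)) (ΞN : ℕ → Set (Rn d → Ξ))
    (est : (N : ℕ) → (J : Finset ℕ) → (J → 𝒟) → Rn d → Ξ) : Prop where
  moment : ∀ N ≥ 1, ∀ ξ ∈ ΞN N, ∀ θ ∈ Θ, Measurable (fun x => g x θ (ξ θ))
  estimated : ∀ N (J : Finset ℕ), ∀ θ ∈ Θ,
    Measurable (fun p : (J → 𝒟) × 𝒟 => g p.2 θ (est N J p.1 θ))
  pointwise : ∀ N ≥ 1, ∃ T ⊆ Θ, T.Countable ∧ ∀ ξ ∈ ΞN N, ∀ θ ∈ Θ,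
    ∃ t : ℕ → Rn d, (∀ j, t j ∈ T) ∧
      ∀ x, Tendsto (fun j => g x (t j) (ξ (t j))) atTop (𝓝 (g x θ (ξ θ)))

/-! ### The Donsker property -/

/-- The outer expectation `E* f = inf {E U : U ≥ f, U integrable}`. -/
def outerExpectation {Ω : Type*} [MeasurableSpace Ω] (P : Measure Ω) (f : Ω → ℝ) : ℝ :=
  sInf {e | ∃ U : Ω → ℝ, Integrable U P ∧ (∀ ω, f ω ≤ U ω) ∧ e = ∫ ω, U ω ∂P}

/-- Weak convergence (in the sense of Hoffmann-Jørgensen) of possibly non-measurable maps `X N`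
into a metric space to a tight Borel measurable map `Y`. -/
def WeaklyConverges {Ω S : Type*} [MeasurableSpace Ω] [PseudoMetricSpace S] (P : Measure Ω)
    (X : ℕ → Ω → S) (Y : Ω → S) : Prop :=
  AEStronglyMeasurable Y P ∧
    ∀ h : S →ᵇ ℝ, Tendsto (fun N => outerExpectation P (fun ω => h (X N ω))) atTop
      (𝓝 (∫ ω, h (Y ω) ∂P))

/-- The space `L^∞(T)` of bounded functions `T → ℝᴸ` with the supremum norm. -/
abbrev LInfty (L : ℕ) {d : ℕ} (T : Set (Rn d)) : Type :=
  lp (fun _ : T => Rn L) ⊤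

/-- The empirical process `𝔾_N g(D_i, θ, ξ₀) = √N (𝔼_N g(D_i, θ, ξ₀) - E g(D, θ, ξ₀))`. -/
def empiricalProcess {Ω 𝒟 Ξ : Type*} [MeasurableSpace 𝒟] {d L : ℕ} (PD : Measure 𝒟)
    (g : 𝒟 → Rn d → Ξ → Rn L) (ξ₀ : Rn d → Ξ) (D : ℕ → Ω → 𝒟) (N : ℕ) (ω : Ω) (θ : Rn d) : Rn L :=
  √(N : ℝ) • ((N : ℝ)⁻¹ • ∑ i ∈ Finset.range N, g (D i ω) θ (ξ₀ θ) - popMoment PD g ξ₀ θ)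

/-- The Donsker property: on an open neighbourhood `Θ'` of `Θ` the empirical process converges
weakly in `L^∞(Θ')` to a centred Gaussian process `Δ` with almost surely continuous paths and
non-degenerate coordinates. -/
def DonskerProperty {Ω 𝒟 Ξ : Type*} [MeasurableSpace Ω] [MeasurableSpace 𝒟] {d L : ℕ}
    (P : Measure Ω) (PD : Measure 𝒟) (g : 𝒟 → Rn d → Ξ → Rn L) (ξ₀ : Rn d → Ξ) (Θ : Set (Rn d))
    (D : ℕ → Ω → 𝒟) : Prop :=
  ∃ Θ' : Set (Rn d), IsOpen Θ' ∧ Θ ⊆ Θ' ∧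
    (∀ θ ∈ Θ', Integrable (fun x => g x θ (ξ₀ θ)) PD) ∧
    ∃ (X : ℕ → Ω → LInfty L Θ') (Δ : Ω → LInfty L Θ'),
      (∀ N ≥ 1, ∀ᵐ ω ∂P, ∀ θ : Θ', X N ω θ = empiricalProcess PD g ξ₀ D N ω θ) ∧
      WeaklyConverges P X Δ ∧
      IsGaussianProcess (fun (θ : Θ') ω => Δ ω θ) P ∧
      (∀ θ : Θ', ∫ ω, Δ ω θ ∂P = 0) ∧
      (∀ᵐ ω ∂P, Continuous (fun θ : Θ' => Δ ω θ)) ∧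
      ∀ (θ : Θ') (l : Fin L), 0 < variance (fun ω => Δ ω θ l) P

/-! ### Stochastic orders -/

/-- The event `A N` holds with probability tending to one (outer probability of the complement). -/
def WithProbTendingToOne {Ω : Type*} [MeasurableSpace Ω] (P : Measure Ω) (A : ℕ → Set Ω) : Prop :=
  Tendsto (fun N => P (A N)ᶜ) atTop (𝓝 0)

/-- `X_N = O_P(ρ_N)` for `[0, ∞]`-valued `X_N` and (possibly random) rates `ρ_N`. -/
def IsBigOP {Ω : Type*} [MeasurableSpace Ω] (P : Measure Ω) (X : ℕ → Ω → ℝ≥0∞)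
    (ρ : ℕ → Ω → ℝ) : Prop :=
  ∀ ε : ℝ, 0 < ε → ∃ M : ℝ, 0 < M ∧
    ∀ᶠ N in atTop, P {ω | ENNReal.ofReal (M * ρ N ω) < X N ω} ≤ ENNReal.ofReal ε

end

/-! The theorem reduces to one bound: with large probability the cross-fitted sample moment is
within `M₁ / √N` of `E g(D, θ, ξ₀(θ))`, simultaneously for all `θ ∈ Θ`. Since `plusNorm` is
1-Lipschitz, a point of the contour set then has population criterion of order `√((1 ∨ ĉ) / N)`, and
partial identification turns this into a distance to the identified set. The other half of the
Hausdorff distance vanishes once the contour set contains the identified set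
(`hausdorffEDist_contourSet_le`).

The uniform bound splits, fold by fold, into bias and noise. The bias `E g(·, ξ̂) - E g(·, ξ₀)` is
at most `s_N = o(N^{-1/2})`: the first derivative along the path starts at zero and the second is at
most `s_N` (`norm_popMoment_sub_le`).

For the noise, condition on the training sample: `ξ̂` is then fixed, the fold is i.i.d., and the
class `𝓕_ξ` at `ξ = ξ̂` has entropy and envelope bounds that do not depend on `ξ`. A maximal
inequality bounds the conditional mean of the supremum by a constant times `√N`, and Markov's
inequality finishes (`exists_measure_fold_deviation_le`). The maximal inequality
(`lintegral_iSup_empirical_le`) is symmetrization followed by chaining of Rademacher sums at a fixed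
sample (`exists_majorant_rademacherSum`). -/

/-- The Rademacher sum `∑ i, ±a i` at the sign vector `σ`. -/
noncomputable def rademacherSum {I : Type*} [Fintype I] (σ : I → Bool) (a : I → ℝ) : ℝ :=
  ∑ i, (if σ i then 1 else -1) * a i

/-! ### Sub-Gaussian bounds and chaining for Rademacher sums -/

section Rademacher

variable {I : Type*} [Fintype I]

lemma rademacherSum_sub (σ : I → Bool) (a b : I → ℝ) :
    rademacherSum σ (fun i => a i - b i) = rademacherSum σ a - rademacherSum σ b := by
  simp [rademacherSum, mul_sub, Finset.sum_sub_distrib]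

lemma rademacherSum_neg (σ : I → Bool) (a : I → ℝ) :
    rademacherSum σ (fun i => - a i) = - rademacherSum σ a := by
  simp [rademacherSum, Finset.sum_neg_distrib]

lemma rademacherSum_div (σ : I → Bool) (a : I → ℝ) (t : ℝ) :
    rademacherSum σ (fun i => a i / t) = rademacherSum σ a / t := by
  simp only [rademacherSum, Finset.sum_div, mul_div_assoc]

/-- A crude bound, enough for the remainder left when chaining stops at a finite scale. -/
lemma abs_rademacherSum_le (σ : I → Bool) (a : EuclideanSpace ℝ I) :
    |rademacherSum σ a| ≤ Fintype.card I * ‖a‖ := by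
  unfold rademacherSum
  refine (Finset.abs_sum_le_sum_abs _ _).trans ?_
  have : ∀ i ∈ Finset.univ, |(if σ i then (1 : ℝ) else -1) * a i| ≤ ‖a‖ := by
    intro i _
    have h := PiLp.norm_apply_le a i
    rw [Real.norm_eq_abs] at h
    split_ifs <;> simpa using h
  simpa using Finset.sum_le_sum this

variable [DecidableEq I]

/-- The moment generating function of a Rademacher sum is sub-Gaussian. -/
lemma sum_exp_rademacherSum_le (a : I → ℝ) :
    ∑ σ : I → Bool, Real.exp (rademacherSum σ a)
      ≤ 2 ^ Fintype.card I * Real.exp ((∑ i, a i ^ 2) / 2) := by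
  -- Independence of the signs: the sum over sign vectors factors over coordinates, and each factor
  -- is `2 cosh (a i) ≤ 2 exp (a i ^ 2 / 2)`.
  have h1 : ∑ σ : I → Bool, Real.exp (rademacherSum σ a) =
      ∏ i, ∑ b : Bool, Real.exp ((if b then 1 else -1) * a i) := by
    rw [Finset.prod_univ_sum, Fintype.piFinset_univ]
    exact Finset.sum_congr rfl fun σ _ => Real.exp_sum _ _
  rw [h1, Finset.sum_div, Real.exp_sum, ← Finset.card_univ, ← Finset.prod_const,
    ← Finset.prod_mul_distrib]
  refine Finset.prod_le_prod (fun i _ => by positivity) fun i _ => ?_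
  have := Real.cosh_le_exp_half_sq (a i)
  rw [Real.cosh_eq] at this
  simp only [Fintype.sum_bool, if_true, one_mul, Bool.false_eq_true, if_false, neg_mul]
  linarith

/-- A finite maximal inequality for Rademacher sums. -/
lemma exists_majorant_rademacherSum_finset (U : Finset (EuclideanSpace ℝ I)) {τ κ : ℝ} (hτ : 0 < τ)
    (hU : ∀ u ∈ U, ‖u‖ ≤ τ) (hκ : (U.card : ℝ) ≤ Real.exp κ) :
    ∃ M : (I → Bool) → ℝ, (∀ σ, ∀ u ∈ U, |rademacherSum σ u| ≤ M σ) ∧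
      ∑ σ, M σ ≤ 2 ^ Fintype.card I * (τ * (κ + 3)) := by
  set E : (I → Bool) → EuclideanSpace ℝ I → ℝ := fun σ u =>
    Real.exp (rademacherSum σ fun i => u i / τ) + Real.exp (rademacherSum σ fun i => - (u i / τ))
    with hE
  -- The inequality `x ≤ κ - 1 + exp (x - κ)` replaces Jensen: this majorant is affine in the
  -- exponentials, so it can be averaged over the signs term by term. Each average of `E` is at most
  -- `4`, which gives `κ - 1 + 4`.
  refine ⟨fun σ => τ * (κ - 1 + Real.exp (-κ) * ∑ u ∈ U, E σ u), ?_, ?_⟩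
  · intro σ u hu
    have h1 : Real.exp (|rademacherSum σ u| / τ) ≤ ∑ u ∈ U, E σ u := by
      refine le_trans ?_ (Finset.single_le_sum (f := E σ) (fun u _ => by positivity) hu)
      simp only [hE, rademacherSum_neg, rademacherSum_div]
      rcases abs_cases (rademacherSum σ u) with h | h <;> rw [h.1]
      · linarith [Real.exp_pos (-(rademacherSum σ u / τ))]
      · rw [neg_div]; linarith [Real.exp_pos (rademacherSum σ u / τ)]
    have h2 := Real.add_one_le_exp (|rademacherSum σ u| / τ - κ)
    rw [sub_eq_add_neg _ κ, Real.exp_add, mul_comm] at h2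
    have h3 := mul_le_mul_of_nonneg_left h1 (Real.exp_pos (-κ)).le
    have h4 : |rademacherSum σ u| / τ ≤ κ - 1 + Real.exp (-κ) * ∑ u ∈ U, E σ u := by linarith
    rw [div_le_iff₀ hτ] at h4
    linarith
  · have hb : ∀ u ∈ U, ∑ σ, E σ u ≤ 2 ^ Fintype.card I * 4 := by
      intro u hu
      have hs : (∑ i, (u i / τ) ^ 2) ≤ 1 := by
        have h1 : ∑ i, (u i) ^ 2 ≤ τ ^ 2 := by
          have := hU u hu
          rw [EuclideanSpace.norm_eq, Real.sqrt_le_left hτ.le] at this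
          simpa using this
        simp only [div_pow, ← Finset.sum_div]
        rw [div_le_one (by positivity)]
        exact h1
      have he : Real.exp ((∑ i, (u i / τ) ^ 2) / 2) ≤ 2 := by
        have h1 : Real.exp (1 / 2) ≤ 2 := by
          have h := Real.exp_one_lt_d9
          have h' : Real.exp (1 / 2) * Real.exp (1 / 2) = Real.exp 1 := by
            rw [← Real.exp_add]; norm_num
          nlinarith [Real.exp_pos (1 / 2)]
        exact (Real.exp_le_exp.2 (by linarith)).trans h1
      have h1 := sum_exp_rademacherSum_le (fun i => u i / τ)
      have h2 := sum_exp_rademacherSum_le (fun i => - (u i / τ))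
      simp only [neg_sq] at h2
      simp only [hE, Finset.sum_add_distrib]
      have : (2 : ℝ) ^ Fintype.card I * Real.exp ((∑ i, (u i / τ) ^ 2) / 2)
        ≤ 2 ^ Fintype.card I * 2 := by gcongr
      linarith
    have hcard : (Fintype.card (I → Bool) : ℝ) = 2 ^ Fintype.card I := by simp
    have hsum : ∑ σ, ∑ u ∈ U, E σ u ≤ Real.exp κ * (2 ^ Fintype.card I * 4) := by
      rw [Finset.sum_comm]
      refine (Finset.sum_le_sum hb).trans ?_
      rw [Finset.sum_const, nsmul_eq_mul]
      gcongr
    rw [← Finset.mul_sum, Finset.sum_add_distrib, ← Finset.mul_sum, Finset.sum_const,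
      Finset.card_univ, nsmul_eq_mul, hcard]
    have h5 : Real.exp (-κ) * ∑ σ, ∑ u ∈ U, E σ u ≤ 2 ^ Fintype.card I * 4 := by
      calc _ ≤ Real.exp (-κ) * (Real.exp κ * (2 ^ Fintype.card I * 4)) := by gcongr
        _ = _ := by rw [← mul_assoc, ← Real.exp_add]; simp
    calc τ * (2 ^ Fintype.card I * (κ - 1) + Real.exp (-κ) * ∑ σ, ∑ u ∈ U, E σ u)
        ≤ τ * (2 ^ Fintype.card I * (κ - 1) + 2 ^ Fintype.card I * 4) := by gcongr
      _ = _ := by ring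

/-- Chaining for Rademacher sums: the average over the signs of the supremum over a set of radius
`R` with covering numbers `exp (A + B j)` at scale `2⁻ʲ R` is at most a constant times `R`. -/
lemma exists_majorant_rademacherSum {ι : Type*} (v : ι → EuclideanSpace ℝ I) {R A B : ℝ}
    (hR : 0 < R) (hA : 0 ≤ A) (hv : ∀ i, ‖v i‖ ≤ R)
    (hnet : ∀ j : ℕ, ∃ C : Finset (EuclideanSpace ℝ I), (C.card : ℝ) ≤ Real.exp (A + B * j) ∧
      ∀ i, ∃ c ∈ C, ‖v i - c‖ ≤ R / 2 ^ j) :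
    ∃ M : (I → Bool) → ℝ, (∀ σ i, |rademacherSum σ (v i)| ≤ M σ) ∧
      ∑ σ, M σ ≤ 2 ^ Fintype.card I * ((3 * (2 * A + 3 + 4 * |B|) + 1) * R) := by
  classical
  -- At scale `0` the net is replaced by `{0}`, admissible because the set has radius `R`; every
  -- chain then starts at `0`.
  have hnet' : ∀ j : ℕ, ∃ C : Finset (EuclideanSpace ℝ I),
      (C.card : ℝ) ≤ Real.exp (A + |B| * j) ∧ (∀ i, ∃ c ∈ C, ‖v i - c‖ ≤ R / 2 ^ j) ∧
      (j = 0 → C = {0}) := by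
    intro j
    rcases Nat.eq_zero_or_pos j with rfl | hj
    · exact ⟨{0}, by simpa using hA, fun i => ⟨0, by simp, by simpa using hv i⟩, fun _ => rfl⟩
    · obtain ⟨C, hC, hC'⟩ := hnet j
      refine ⟨C, hC.trans (Real.exp_le_exp.2 ?_), hC', fun h => absurd h hj.ne'⟩
      gcongr
      exact le_abs_self B
  choose C hCcard hC hC0 using hnet'
  choose π hπmem hπ using hC
  -- The right side is the closed form of `3R ∑_{1 ≤ j ≤ J} (2A + 3 + 2|B|j) / 2^j`, the sum of the
  -- finite maximal bounds over the links of the chain.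
  have hchain : ∀ J : ℕ, ∃ M : (I → Bool) → ℝ, (∀ σ i, |rademacherSum σ (π J i)| ≤ M σ) ∧
      ∑ σ, M σ ≤ 2 ^ Fintype.card I * (3 * R * ((2 * A + 3 + 4 * |B|) -
        (2 * A + 3 + 4 * |B| + 2 * |B| * J) / 2 ^ J)) := by
    intro J
    induction J with
    | zero =>
      refine ⟨fun _ => 0, fun σ i => ?_, by simp⟩
      have : π 0 i = 0 := by
        have := hπmem 0 i
        rw [hC0 0 rfl] at this
        simpa using this
      simp [this, rademacherSum]
    | succ J ih =>
      obtain ⟨M, hM, hMs⟩ := ih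
      set τ : ℝ := 3 * R / 2 ^ (J + 1) with hτdef
      have hτ : 0 < τ := by positivity
      -- Only differences of length at most `τ` are kept. All actual links survive, by the triangle
      -- inequality `R / 2^J + R / 2^(J+1) = τ`.
      set U : Finset (EuclideanSpace ℝ I) :=
        ((C (J + 1) ×ˢ C J).image (fun p => p.1 - p.2)).filter (fun u => ‖u‖ ≤ τ) with hUdef
      have hUcard : (U.card : ℝ) ≤ Real.exp (2 * A + 2 * |B| * (J + 1)) := by
        have h1 : U.card ≤ (C (J + 1)).card * (C J).card :=
          (Finset.card_filter_le _ _).trans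
            (Finset.card_image_le.trans (Finset.card_product _ _).le)
        calc (U.card : ℝ) ≤ (C (J + 1)).card * (C J).card := by exact_mod_cast h1
          _ ≤ Real.exp (A + |B| * (J + 1 : ℕ)) * Real.exp (A + |B| * J) := by
            gcongr
            · exact hCcard _
            · exact hCcard _
          _ = Real.exp ((A + |B| * (J + 1 : ℕ)) + (A + |B| * J)) := (Real.exp_add _ _).symm
          _ ≤ _ := by
            refine Real.exp_le_exp.2 ?_
            push_cast
            nlinarith [abs_nonneg B]
      obtain ⟨M', hM', hMs'⟩ := exists_majorant_rademacherSum_finset U hτ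
        (fun u hu => (Finset.mem_filter.1 hu).2) hUcard
      refine ⟨fun σ => M σ + M' σ, fun σ i => ?_, ?_⟩
      · have hmem : π (J + 1) i - π J i ∈ U := by
          refine Finset.mem_filter.2 ⟨Finset.mem_image.2
            ⟨(π (J + 1) i, π J i), Finset.mem_product.2 ⟨hπmem _ _, hπmem _ _⟩, rfl⟩, ?_⟩
          calc ‖π (J + 1) i - π J i‖ = ‖(v i - π J i) - (v i - π (J + 1) i)‖ := by
                congr 1; abel
            _ ≤ R / 2 ^ J + R / 2 ^ (J + 1) :=
              (norm_sub_le _ _).trans (add_le_add (hπ _ _) (hπ _ _))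
            _ = τ := by rw [hτdef]; field_simp; ring
        have h1 := hM σ i
        have h2 := hM' σ _ hmem
        have h3 : rademacherSum σ (π (J + 1) i) =
            rademacherSum σ (π J i) + rademacherSum σ (π (J + 1) i - π J i) := by
          have : rademacherSum σ (π (J + 1) i - π J i) =
            rademacherSum σ (fun k => π (J + 1) i k - π J i k) := rfl
          rw [this, rademacherSum_sub]
          ring
        rw [h3]
        exact (abs_add_le _ _).trans (add_le_add h1 h2)
      · rw [Finset.sum_add_distrib]
        refine (add_le_add hMs hMs').trans (le_of_eq ?_)
        rw [hτdef, ← mul_add]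
        congr 1
        push_cast
        field_simp
        ring
  -- At this scale the trivial bound on the remainder is already `R`; it accounts for the `+ 1` in
  -- the constant.
  obtain ⟨J, hJ⟩ : ∃ J : ℕ, (Fintype.card I : ℝ) / 2 ^ J ≤ 1 := by
    obtain ⟨J, hJ⟩ := pow_unbounded_of_one_lt (Fintype.card I : ℝ) (one_lt_two (α := ℝ))
    exact ⟨J, (div_le_one (by positivity)).2 hJ.le⟩
  obtain ⟨M, hM, hMs⟩ := hchain J
  refine ⟨fun σ => M σ + R, fun σ i => ?_, ?_⟩
  · have h1 := abs_rademacherSum_le σ (v i - π J i)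
    have h2 : rademacherSum σ (v i - π J i : EuclideanSpace ℝ I) =
        rademacherSum σ (v i) - rademacherSum σ (π J i) :=
      rademacherSum_sub σ (v i) (π J i)
    have h3 : (Fintype.card I : ℝ) * ‖v i - π J i‖ ≤ R := by
      calc (Fintype.card I : ℝ) * ‖v i - π J i‖ ≤ Fintype.card I * (R / 2 ^ J) := by
            gcongr; exact hπ _ _
        _ = (Fintype.card I : ℝ) / 2 ^ J * R := by ring
        _ ≤ 1 * R := by gcongr
        _ = R := one_mul R
    have h4 := hM σ i
    rw [h2] at h1
    rw [abs_le] at *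
    constructor <;> linarith [h1.1, h1.2, h4.1, h4.2]
  · rw [Finset.sum_add_distrib, Finset.sum_const, Finset.card_univ, nsmul_eq_mul]
    have hcard : (Fintype.card (I → Bool) : ℝ) = 2 ^ Fintype.card I := by simp
    rw [hcard]
    refine (add_le_add_left hMs _).trans ?_
    rw [← mul_add]
    gcongr
    have h5 : 0 ≤ (2 * A + 3 + 4 * |B| + 2 * |B| * J) / 2 ^ J := by positivity
    nlinarith

end Rademacher

/-! ### From uniform entropy to a maximal inequality -/

section Maximal

variable {I : Type*} [Fintype I] {𝒟 : Type*}

/-- Finite nets for the values of the class at a finite sample, from the uniform entropy bound. -/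
lemma UniformEntropyBound.exists_net {𝓕 : Set (𝒟 → ℝ)} {F : 𝒟 → ℝ} {a v : ℝ}
    (h : UniformEntropyBound 𝓕 F a v) (x : I → 𝒟) (hF : 0 < √(∑ k, F (x k) ^ 2)) (j : ℕ) :
    ∃ C : Finset (EuclideanSpace ℝ I),
      (C.card : ℝ) ≤ Real.exp (|v| * |Real.log a| + |v| * Real.log 2 * j) ∧
      ∀ f ∈ 𝓕, ∃ c ∈ C, ‖(WithLp.toLp 2 (fun k => f (x k)) : EuclideanSpace ℝ I) - c‖ ≤
        √(∑ k, F (x k) ^ 2) / 2 ^ j := by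
  classical
  have : Nonempty I := by
    by_contra hI
    rw [not_nonempty_iff] at hI
    simp at hF
  set n := Fintype.card I with hn
  have hn0 : 0 < n := Fintype.card_pos
  have hnR : (0 : ℝ) < n := by exact_mod_cast hn0
  set e : Fin n ≃ I := (Fintype.equivFin I).symm
  -- With equal weights on the sample points, the `L²(Q)` norm is the Euclidean norm divided by
  -- `√n`, so covers transfer by rescaling.
  set w : Fin n → ℝ := fun _ => (n : ℝ)⁻¹
  have hnorm : ∀ u : I → ℝ, ‖(WithLp.toLp 2 (fun i => √(w i) * u (e i)) : Rn n)‖ =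
      √((n : ℝ)⁻¹) * ‖(WithLp.toLp 2 u : EuclideanSpace ℝ I)‖ := by
    intro u
    rw [EuclideanSpace.norm_eq, EuclideanSpace.norm_eq, ← Real.sqrt_mul (by positivity)]
    congr 1
    simp only [w, Real.norm_eq_abs, sq_abs, mul_pow, Real.sq_sqrt (inv_nonneg.2 hnR.le)]
    rw [← Finset.mul_sum, Equiv.sum_comp e (fun i => u i ^ 2)]
  have hFn : ‖discreteL2 w (fun i => x (e i)) F‖ = √((n : ℝ)⁻¹) * √(∑ k, F (x k) ^ 2) := by
    have := hnorm (fun k => F (x k))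
    rw [EuclideanSpace.norm_eq (WithLp.toLp 2 fun k => F (x k) : EuclideanSpace ℝ I)] at this
    simpa [discreteL2] using this
  have hs : 0 < √((n : ℝ)⁻¹) := Real.sqrt_pos.2 (by positivity)
  obtain ⟨h1, h2⟩ := h n w (fun i => x (e i)) (fun i => by positivity)
    (by simp [w, hnR.ne']) (by rw [hFn]; positivity) ((1 / 2) ^ j) (by positivity)
    (pow_le_one₀ (by norm_num) (by norm_num))
  set ρ : ℝ≥0 := Real.toNNReal ((1 / 2) ^ j * ‖discreteL2 w (fun i => x (e i)) F‖) with hρ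
  obtain ⟨C, hC1, hC2⟩ : ∃ C : Set (Rn n), Metric.IsCover ρ
      (discreteL2 w (fun i => x (e i)) '' 𝓕) C ∧ C.encard =
        Metric.externalCoveringNumber ρ (discreteL2 w (fun i => x (e i)) '' 𝓕) := by
    have hne : Nonempty {C : Set (Rn n) // Metric.IsCover ρ
        (discreteL2 w (fun i => x (e i)) '' 𝓕) C} := ⟨⟨_, Metric.IsCover.refl _ _⟩⟩
    obtain ⟨C, hC⟩ := ENat.exists_eq_iInf (fun C : {C : Set (Rn n) // Metric.IsCover ρ
        (discreteL2 w (fun i => x (e i)) '' 𝓕) C} => (C : Set (Rn n)).encard)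
    refine ⟨C, C.2, ?_⟩
    rw [hC, Metric.externalCoveringNumber, iInf_subtype]
  rw [← hC2] at h1 h2
  have hCfin : C.Finite := Set.encard_ne_top_iff.1 h1
  have hlog : v * Real.log (a / (1 / 2) ^ j) ≤ |v| * |Real.log a| + |v| * Real.log 2 * j := by
    have hl2 : 0 ≤ Real.log 2 := Real.log_nonneg (by norm_num)
    have hb : |Real.log (a / (1 / 2) ^ j)| ≤ |Real.log a| + Real.log 2 * j := by
      -- Here `a` is an arbitrary real: `Real.log 0 = 0` settles `a = 0`, and otherwise
      -- `Real.log_div` needs only nonzero arguments.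
      by_cases ha : a = 0
      · simp only [ha, zero_div, Real.log_zero, abs_zero, zero_add]; positivity
      · rw [Real.log_div ha (by positivity), Real.log_pow, one_div, Real.log_inv]
        refine (abs_sub _ _).trans (le_of_eq ?_)
        rw [abs_mul, abs_neg, abs_of_nonneg hl2, Nat.abs_cast, mul_comm (Real.log 2)]
    calc v * Real.log (a / (1 / 2) ^ j) ≤ |v| * |Real.log (a / (1 / 2) ^ j)| := by
          rw [← abs_mul]; exact le_abs_self _
      _ ≤ |v| * (|Real.log a| + Real.log 2 * j) := by gcongr
      _ = _ := by ring
  refine ⟨hCfin.toFinset.image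
    (fun c => WithLp.toLp 2 (fun k => c (e.symm k) / √((n : ℝ)⁻¹))), ?_, ?_⟩
  · have hcard : (C.encard.toNat : ℝ) = hCfin.toFinset.card := by
      rw [hCfin.encard_eq_coe_toFinset_card]; simp
    have h3 : ((hCfin.toFinset.image (fun c : Rn n => (WithLp.toLp 2
        (fun k => c (e.symm k) / √((n : ℝ)⁻¹)) : EuclideanSpace ℝ I))).card : ℝ) ≤
        hCfin.toFinset.card := by exact_mod_cast Finset.card_image_le
    refine h3.trans ?_
    rw [hcard] at h2
    rcases Nat.eq_zero_or_pos hCfin.toFinset.card with h0 | h0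
    · rw [h0]; simp only [Nat.cast_zero]; positivity
    · rw [← Real.exp_log (show (0 : ℝ) < hCfin.toFinset.card by exact_mod_cast h0)]
      exact Real.exp_le_exp.2 (h2.trans hlog)
  · intro f hf
    obtain ⟨c, hc, hfc⟩ := hC1 (Set.mem_image_of_mem _ hf)
    refine ⟨_, Finset.mem_image_of_mem _ (hCfin.mem_toFinset.2 hc), ?_⟩
    have hfc' : dist (discreteL2 w (fun i => x (e i)) f) c ≤ ρ := by
      have : edist (discreteL2 w (fun i => x (e i)) f) c ≤ ρ := hfc
      rw [edist_nndist] at this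
      exact_mod_cast this
    rw [hρ, Real.coe_toNNReal _ (by positivity), hFn, dist_eq_norm] at hfc'
    have h4 := hnorm (fun k => f (x k) - c (e.symm k) / √((n : ℝ)⁻¹))
    have h5 : (WithLp.toLp 2 (fun i => √(w i) * (f (x (e i)) - c (e.symm (e i)) / √((n : ℝ)⁻¹))) :
        Rn n) = discreteL2 w (fun i => x (e i)) f - c := by
      ext i
      simp only [discreteL2, PiLp.sub_apply, Equiv.symm_apply_apply, w]
      field_simp
    rw [h5] at h4
    rw [h4] at hfc'
    have h6 : (WithLp.toLp 2 (fun k => f (x k)) : EuclideanSpace ℝ I) -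
        WithLp.toLp 2 (fun k => c (e.symm k) / √((n : ℝ)⁻¹)) =
        WithLp.toLp 2 (fun k => f (x k) - c (e.symm k) / √((n : ℝ)⁻¹)) := rfl
    rw [h6]
    refine le_of_mul_le_mul_left (hfc'.trans (le_of_eq ?_)) hs
    rw [one_div, inv_pow]
    field_simp

/-- The constant of the maximal inequality for a class with entropy `v log (a / ε)`. -/
noncomputable def entropyConst (a v : ℝ) : ℝ :=
  3 * (2 * (|v| * |Real.log a|) + 3 + 4 * |(|v| * Real.log 2)|) + 1

lemma entropyConst_nonneg (a v : ℝ) : 0 ≤ entropyConst a v := by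
  unfold entropyConst; positivity

/-- The sign average of the supremum of Rademacher sums over a class with a uniform entropy
bound. -/
lemma sum_iSup_rademacherSum_le [DecidableEq I] {𝓕 : Set (𝒟 → ℝ)} {F : 𝒟 → ℝ} {a v : ℝ}
    (h : UniformEntropyBound 𝓕 F a v) {ι : Type*} (f : ι → 𝒟 → ℝ) (hf : ∀ i, f i ∈ 𝓕)
    (x : I → 𝒟) (hF : ∀ i k, |f i (x k)| ≤ F (x k)) :
    ∑ σ : I → Bool, ⨆ i, ‖rademacherSum σ (fun k => f i (x k))‖ₑ ≤
      2 ^ Fintype.card I * ENNReal.ofReal (entropyConst a v * √(∑ k, F (x k) ^ 2)) := by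
  rcases isEmpty_or_nonempty ι with hι | ⟨⟨i₀⟩⟩
  · simp
  -- The entropy bound says nothing when the envelope vanishes on the sample, but then so does every
  -- function of the family.
  rcases (Real.sqrt_nonneg (∑ k, F (x k) ^ 2)).eq_or_lt with h0 | h0
  · have hz : ∀ k, F (x k) = 0 := by
      have h1 := (Real.sqrt_eq_zero (by positivity)).1 h0.symm
      intro k
      have := (Finset.sum_eq_zero_iff_of_nonneg (fun k _ => sq_nonneg _)).1 h1 k (Finset.mem_univ k)
      simpa using this
    have hz' : ∀ i k, f i (x k) = 0 := fun i k => by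
      have := hF i k
      rw [hz k] at this
      exact abs_eq_zero.1 (le_antisymm this (abs_nonneg _))
    simp [hz', rademacherSum]
  · have hv : ∀ i, ‖(WithLp.toLp 2 (fun k => f i (x k)) : EuclideanSpace ℝ I)‖ ≤
        √(∑ k, F (x k) ^ 2) := by
      intro i
      rw [EuclideanSpace.norm_eq]
      refine Real.sqrt_le_sqrt (Finset.sum_le_sum fun k _ => ?_)
      simpa using pow_le_pow_left₀ (abs_nonneg _) (hF i k) 2
    obtain ⟨M, hM, hMs⟩ := exists_majorant_rademacherSum
      (fun i => (WithLp.toLp 2 (fun k => f i (x k)) : EuclideanSpace ℝ I)) h0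
      (A := |v| * |Real.log a|) (B := |v| * Real.log 2) (by positivity) hv
      (fun j => by
        obtain ⟨C, hC, hC'⟩ := h.exists_net x h0 j
        exact ⟨C, hC, fun i => hC' _ (hf i)⟩)
    have hM0 : ∀ σ, 0 ≤ M σ := fun σ => (abs_nonneg _).trans (hM σ i₀)
    calc ∑ σ : I → Bool, ⨆ i, ‖rademacherSum σ (fun k => f i (x k))‖ₑ
        ≤ ∑ σ, ENNReal.ofReal (M σ) := by
          refine Finset.sum_le_sum fun σ _ => iSup_le fun i => ?_
          rw [Real.enorm_eq_ofReal_abs]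
          exact ENNReal.ofReal_le_ofReal (hM σ i)
      _ = ENNReal.ofReal (∑ σ, M σ) := (ENNReal.ofReal_sum_of_nonneg fun σ _ => hM0 σ).symm
      _ ≤ ENNReal.ofReal (2 ^ Fintype.card I * (entropyConst a v * √(∑ k, F (x k) ^ 2))) :=
          ENNReal.ofReal_le_ofReal hMs
      _ = _ := by
          rw [ENNReal.ofReal_mul (by positivity), ENNReal.ofReal_pow (by norm_num)]
          simp

variable [MeasurableSpace 𝒟] (μ : Measure 𝒟) [IsProbabilityMeasure μ]

/-- The `L¹` norm is at most the `L²` norm under a probability measure, and the latter is explicit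
because the coordinates have the same law. -/
lemma lintegral_sqrt_sum_sq_le {F : 𝒟 → ℝ} (hF : Measurable F) :
    ∫⁻ x : I → 𝒟, ENNReal.ofReal √(∑ k, F (x k) ^ 2) ∂Measure.pi (fun _ => μ) ≤
      ENNReal.ofReal √(Fintype.card I) * eLpNorm F 2 μ := by
  set G : (I → 𝒟) → ℝ := fun x => √(∑ k, F (x k) ^ 2) with hG
  have hGm : Measurable G := by fun_prop
  have h1 : ∫⁻ x, ENNReal.ofReal (G x) ∂Measure.pi (fun _ => μ) =
      eLpNorm G 1 (Measure.pi fun _ => μ) := by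
    rw [eLpNorm_one_eq_lintegral_enorm]
    refine lintegral_congr fun x => ?_
    rw [Real.enorm_eq_ofReal (Real.sqrt_nonneg _)]
  have h2 : eLpNorm G 2 (Measure.pi fun _ => μ) =
      ENNReal.ofReal √(Fintype.card I) * eLpNorm F 2 μ := by
    rw [eLpNorm_eq_lintegral_rpow_enorm_toReal (by norm_num) (by norm_num),
      eLpNorm_eq_lintegral_rpow_enorm_toReal (by norm_num) (by norm_num)]
    have h3 : ∀ x, ‖G x‖ₑ ^ (2 : ℝ≥0∞).toReal = ∑ k, ‖F (x k)‖ₑ ^ (2 : ℝ≥0∞).toReal := by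
      intro x
      simp only [ENNReal.toReal_ofNat, ENNReal.rpow_ofNat]
      rw [Real.enorm_eq_ofReal (Real.sqrt_nonneg _), ← ENNReal.ofReal_pow (Real.sqrt_nonneg _),
        Real.sq_sqrt (by positivity), ENNReal.ofReal_sum_of_nonneg fun k _ => sq_nonneg _]
      refine Finset.sum_congr rfl fun k _ => ?_
      rw [Real.enorm_eq_ofReal_abs, ← ENNReal.ofReal_pow (abs_nonneg _), sq_abs]
    simp only [h3]
    rw [lintegral_finsetSum _ (fun k _ => by fun_prop)]
    have h4 : ∀ k : I, ∫⁻ x : I → 𝒟, ‖F (x k)‖ₑ ^ (2 : ℝ≥0∞).toReal ∂Measure.pi (fun _ => μ) =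
        ∫⁻ y, ‖F y‖ₑ ^ (2 : ℝ≥0∞).toReal ∂μ := fun k =>
      (measurePreserving_eval (fun _ : I => μ) k).lintegral_comp
        (f := fun y => ‖F y‖ₑ ^ (2 : ℝ≥0∞).toReal) (by fun_prop)
    simp only [h4, Finset.sum_const, Finset.card_univ, nsmul_eq_mul]
    rw [ENNReal.mul_rpow_of_nonneg _ _ (by norm_num)]
    congr 1
    rw [Real.sqrt_eq_rpow, ← ENNReal.ofReal_rpow_of_nonneg (by positivity) (by norm_num)]
    simp
  rw [h1, ← h2]
  exact eLpNorm_le_eLpNorm_of_exponent_le (by norm_num) hGm.aestronglyMeasurable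

/-- Symmetrization. -/
lemma lintegral_iSup_centered_le [DecidableEq I] {ι : Type*} [Countable ι] (f : ι → 𝒟 → ℝ)
    (hfm : ∀ i, Measurable (f i)) (hfi : ∀ i, Integrable (f i) μ) :
    2 ^ Fintype.card I * ∫⁻ x : I → 𝒟, ⨆ i, ‖∑ k, f i (x k) - Fintype.card I * ∫ y, f i y ∂μ‖ₑ
        ∂Measure.pi (fun _ => μ) ≤
      2 * ∫⁻ x : I → 𝒟, ∑ σ : I → Bool, ⨆ i, ‖rademacherSum σ (fun k => f i (x k))‖ₑ
        ∂Measure.pi (fun _ => μ) := by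
  set π : Measure (I → 𝒟) := Measure.pi (fun _ => μ) with hπ
  set Φ : (I → 𝒟 × 𝒟) → ℝ≥0∞ := fun z => ⨆ i, ‖∑ k, (f i (z k).1 - f i (z k).2)‖ₑ with hΦ
  have hΦm : Measurable Φ := by
    refine Measurable.iSup fun i => ?_
    have := hfm i
    fun_prop
  have hmp := measurePreserving_arrowProdEquivProdArrow 𝒟 𝒟 I (fun _ => μ) (fun _ => μ)
  have hSm : ∀ σ : I → Bool,
      Measurable fun x : I → 𝒟 => ⨆ i, ‖rademacherSum σ (fun k => f i (x k))‖ₑ := by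
    intro σ
    refine Measurable.iSup fun i => ?_
    have := hfm i
    unfold rademacherSum
    fun_prop
  have hint : ∀ i k, Integrable (fun y : I → 𝒟 => f i (y k)) π := fun i k =>
    (measurePreserving_eval (fun _ : I => μ) k).integrable_comp_of_integrable (hfi i)
  -- The mean is an average over an independent copy of the sample; pulling this average out of the
  -- norm and the supremum only increases the value.
  have hstep1 : ∀ x : I → 𝒟, (⨆ i, ‖∑ k, f i (x k) - Fintype.card I * ∫ y, f i y ∂μ‖ₑ) ≤
      ∫⁻ y, Φ (fun k => (x k, y k)) ∂π := by
    intro x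
    refine iSup_le fun i => ?_
    have h1 : ∑ k, f i (x k) - Fintype.card I * ∫ y, f i y ∂μ =
        ∫ y : I → 𝒟, ∑ k, (f i (x k) - f i (y k)) ∂π := by
      rw [integral_finsetSum (f := fun k (y : I → 𝒟) => f i (x k) - f i (y k)) _
        fun k _ => (integrable_const _).sub (hint i k)]
      have h2 : ∀ k : I, ∫ y : I → 𝒟, f i (x k) - f i (y k) ∂π = f i (x k) - ∫ y, f i y ∂μ := by
        intro k
        rw [integral_sub (integrable_const _) (hint i k)]
        congr 1
        · simp [hπ]
        · exact integral_comp_eval (μ := fun _ : I => μ) (i := k) (hfi i).aestronglyMeasurable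
      simp only [h2, Finset.sum_sub_distrib, Finset.sum_const, Finset.card_univ, nsmul_eq_mul]
    rw [h1]
    refine (enorm_integral_le_lintegral_enorm _).trans (lintegral_mono fun y => ?_)
    exact le_iSup (fun i => ‖∑ k, (f i (x k) - f i (y k))‖ₑ) i
  have hstep2 : ∫⁻ x, ∫⁻ y, Φ (fun k => (x k, y k)) ∂π ∂π =
      ∫⁻ z, Φ z ∂Measure.pi (fun _ : I => μ.prod μ) := by
    rw [← lintegral_prod (f := fun p : (I → 𝒟) × (I → 𝒟) => Φ (fun k => (p.1 k, p.2 k)))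
      (by
        refine (hΦm.comp ?_).aemeasurable
        fun_prop)]
    rw [← hmp.lintegral_comp_emb (MeasurableEquiv.measurableEmbedding _)]
    rfl
  -- Swapping the two members of the pairs with sign `-1` preserves the law and turns differences
  -- into signed differences. The two halves are bounded separately, whence the factor `2`.
  have hstep3 : ∀ σ : I → Bool, ∫⁻ z, Φ z ∂Measure.pi (fun _ : I => μ.prod μ) ≤
      2 * ∫⁻ x : I → 𝒟, ⨆ i, ‖rademacherSum σ (fun k => f i (x k))‖ₑ ∂π := by
    intro σ
    have hsw : MeasurePreserving
        (fun (z : I → 𝒟 × 𝒟) k => (if σ k then id else Prod.swap : 𝒟 × 𝒟 → 𝒟 × 𝒟) (z k))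
        (Measure.pi (fun _ : I => μ.prod μ)) (Measure.pi (fun _ : I => μ.prod μ)) := by
      refine measurePreserving_pi _ _ fun k => ?_
      split_ifs
      · exact MeasurePreserving.id _
      · exact Measure.measurePreserving_swap
    rw [← hsw.lintegral_comp hΦm]
    have hle : ∀ z : I → 𝒟 × 𝒟,
        Φ (fun k => (if σ k then id else Prod.swap : 𝒟 × 𝒟 → 𝒟 × 𝒟) (z k)) ≤
        (⨆ i, ‖rademacherSum σ (fun k => f i (z k).1)‖ₑ) +
          ⨆ i, ‖rademacherSum σ (fun k => f i (z k).2)‖ₑ := by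
      intro z
      refine iSup_le fun i => ?_
      have h1 : ∑ k, (f i ((if σ k then id else Prod.swap : 𝒟 × 𝒟 → 𝒟 × 𝒟) (z k)).1 -
          f i ((if σ k then id else Prod.swap : 𝒟 × 𝒟 → 𝒟 × 𝒟) (z k)).2) =
          rademacherSum σ (fun k => f i (z k).1) - rademacherSum σ (fun k => f i (z k).2) := by
        rw [← rademacherSum_sub]
        refine Finset.sum_congr rfl fun k _ => ?_
        split_ifs <;> simp
      rw [h1]
      refine enorm_sub_le.trans (add_le_add ?_ ?_)
      · exact le_iSup (fun i => ‖rademacherSum σ (fun k => f i (z k).1)‖ₑ) i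
      · exact le_iSup (fun i => ‖rademacherSum σ (fun k => f i (z k).2)‖ₑ) i
    refine (lintegral_mono hle).trans ?_
    have hm1 : MeasurePreserving (fun (z : I → 𝒟 × 𝒟) k => (z k).1)
        (Measure.pi (fun _ : I => μ.prod μ)) π :=
      measurePreserving_pi _ _ fun _ => measurePreserving_fst
    have hm2 : MeasurePreserving (fun (z : I → 𝒟 × 𝒟) k => (z k).2)
        (Measure.pi (fun _ : I => μ.prod μ)) π :=
      measurePreserving_pi _ _ fun _ => measurePreserving_snd
    rw [lintegral_add_left (f := fun z : I → 𝒟 × 𝒟 =>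
      ⨆ i, ‖rademacherSum σ (fun k => f i (z k).1)‖ₑ) ((hSm σ).comp hm1.measurable), two_mul]
    exact le_of_eq (congrArg₂ _ (hm1.lintegral_comp (hSm σ)) (hm2.lintegral_comp (hSm σ)))
  calc 2 ^ Fintype.card I * ∫⁻ x : I → 𝒟,
        ⨆ i, ‖∑ k, f i (x k) - Fintype.card I * ∫ y, f i y ∂μ‖ₑ ∂π
      ≤ 2 ^ Fintype.card I * ∫⁻ z, Φ z ∂Measure.pi (fun _ : I => μ.prod μ) := by
        rw [← hstep2]
        gcongr with x
        exact hstep1 x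
    _ = ∑ σ : I → Bool, ∫⁻ z, Φ z ∂Measure.pi (fun _ : I => μ.prod μ) := by simp
    _ ≤ ∑ σ : I → Bool, 2 * ∫⁻ x : I → 𝒟, ⨆ i, ‖rademacherSum σ (fun k => f i (x k))‖ₑ ∂π :=
        Finset.sum_le_sum fun σ _ => hstep3 σ
    _ = _ := by rw [← Finset.mul_sum, lintegral_finsetSum _ fun σ _ => hSm σ]

/-- A maximal inequality for the empirical process over a class with a uniform entropy bound. -/
theorem lintegral_iSup_empirical_le {𝓕 : Set (𝒟 → ℝ)} {F : 𝒟 → ℝ} {a v : ℝ}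
    (h : UniformEntropyBound 𝓕 F a v) (hF : MemLp F 2 μ) (hFm : Measurable F)
    {ι : Type*} [Countable ι] (f : ι → 𝒟 → ℝ) (hf : ∀ i, f i ∈ 𝓕) (hfm : ∀ i, Measurable (f i))
    (hfF : ∀ᵐ x ∂μ, ∀ i, |f i x| ≤ F x) :
    ∫⁻ x : I → 𝒟, ⨆ i, ‖∑ k, f i (x k) - Fintype.card I * ∫ y, f i y ∂μ‖ₑ
        ∂Measure.pi (fun _ => μ) ≤
      ENNReal.ofReal (2 * entropyConst a v) * (ENNReal.ofReal √(Fintype.card I) * eLpNorm F 2 μ) := by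
  classical
  have hfi : ∀ i, Integrable (f i) μ := fun i =>
    (hF.integrable (by norm_num)).mono' (hfm i).aestronglyMeasurable
      (hfF.mono fun x hx => hx i)
  have h1 := lintegral_iSup_centered_le (I := I) μ f hfm hfi
  have hae : ∀ᵐ x ∂Measure.pi (fun _ : I => μ), ∀ k i, |f i (x k)| ≤ F (x k) := by
    rw [ae_all_iff]
    intro k
    exact (Measure.quasiMeasurePreserving_eval (fun _ : I => μ) k).ae hfF
  have h2 : ∫⁻ x : I → 𝒟, ∑ σ : I → Bool, ⨆ i, ‖rademacherSum σ (fun k => f i (x k))‖ₑ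
        ∂Measure.pi (fun _ => μ) ≤ 2 ^ Fintype.card I * (ENNReal.ofReal (entropyConst a v) *
          (ENNReal.ofReal √(Fintype.card I) * eLpNorm F 2 μ)) := by
    calc _ ≤ ∫⁻ x : I → 𝒟, 2 ^ Fintype.card I * (ENNReal.ofReal (entropyConst a v) *
          ENNReal.ofReal √(∑ k, F (x k) ^ 2)) ∂Measure.pi (fun _ => μ) := by
          refine lintegral_mono_ae (hae.mono fun x hx => ?_)
          rw [← ENNReal.ofReal_mul (entropyConst_nonneg a v)]
          exact sum_iSup_rademacherSum_le h f hf x fun i k => hx k i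
      _ = 2 ^ Fintype.card I * (ENNReal.ofReal (entropyConst a v) *
          ∫⁻ x : I → 𝒟, ENNReal.ofReal √(∑ k, F (x k) ^ 2) ∂Measure.pi (fun _ => μ)) := by
          rw [lintegral_const_mul' _ _ (by simp), lintegral_const_mul' _ _ (by simp)]
      _ ≤ _ := by gcongr; exact lintegral_sqrt_sum_sq_le μ hFm
  have h3 := h1.trans (mul_le_mul_right h2 2)
  rw [mul_left_comm] at h3
  have h4 := (ENNReal.mul_le_mul_iff_right (by simp) (by simp)).1 h3
  refine h4.trans (le_of_eq ?_)
  rw [ENNReal.ofReal_mul (by norm_num), ← mul_assoc]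
  simp

end Maximal

/-! ### Concentration of cross-fitted fold sums -/

section Folds

/-- Markov's inequality conditionally on the first coordinate. -/
lemma prod_measure_conditional_markov {α β : Type*} [MeasurableSpace α] [MeasurableSpace β]
    (μ : Measure α) (ν : Measure β) [IsProbabilityMeasure μ] [SFinite ν]
    {H : α × β → ℝ≥0∞} (hH : Measurable H) (c t : ℝ≥0∞) (ht : t ≠ 0) (ht' : t ≠ ⊤) :
    MeasurableSet {q : α × β | ∫⁻ y, H (q.1, y) ∂ν ≤ c ∧ t < H q} ∧
    (μ.prod ν) {q : α × β | ∫⁻ y, H (q.1, y) ∂ν ≤ c ∧ t < H q} ≤ c / t := by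
  have hG : Measurable fun p => ∫⁻ y, H (p, y) ∂ν := hH.lintegral_prod_right'
  have hS : MeasurableSet {q : α × β | ∫⁻ y, H (q.1, y) ∂ν ≤ c ∧ t < H q} :=
    (measurableSet_le (hG.comp measurable_fst) measurable_const).inter
      (measurableSet_lt measurable_const hH)
  refine ⟨hS, ?_⟩
  rw [Measure.prod_apply hS]
  calc ∫⁻ p, ν (Prod.mk p ⁻¹' {q : α × β | ∫⁻ y, H (q.1, y) ∂ν ≤ c ∧ t < H q}) ∂μ
      ≤ ∫⁻ _, c / t ∂μ := by
        refine lintegral_mono fun p => ?_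
        -- The bound on the conditional mean is part of the event, so a section where it fails is
        -- empty.
        by_cases hp : ∫⁻ y, H (p, y) ∂ν ≤ c
        · calc ν (Prod.mk p ⁻¹' {q : α × β | ∫⁻ y, H (q.1, y) ∂ν ≤ c ∧ t < H q})
              ≤ ν {y | t ≤ H (p, y)} := measure_mono fun y hy => hy.2.le
            _ ≤ (∫⁻ y, H (p, y) ∂ν) / t :=
              meas_ge_le_lintegral_div (hH.comp measurable_prodMk_left).aemeasurable ht ht'
            _ ≤ c / t := by gcongr
        · have : Prod.mk p ⁻¹' {q : α × β | ∫⁻ y, H (q.1, y) ∂ν ≤ c ∧ t < H q} = ∅ := by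
            ext y
            simp [hp]
          rw [this]
          simp
    _ = c / t := by simp

/-- Disjoint blocks of an i.i.d. sequence are independent. With `J` the training block and `I` the
fold, this makes conditioning on the training sample a Fubini argument. -/
lemma map_restrict_pair_eq_prod {Ω 𝒟 : Type*} [MeasurableSpace Ω] [MeasurableSpace 𝒟]
    {P : Measure Ω} [IsProbabilityMeasure P] {PD : Measure 𝒟} {D : ℕ → Ω → 𝒟}
    (hD_meas : ∀ i, Measurable (D i)) (hD_indep : iIndepFun D P) (hD_law : ∀ i, P.map (D i) = PD)
    {J I : Finset ℕ} (hJI : Disjoint J I) :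
    P.map (fun ω => ((fun i : J => D i ω), (fun i : I => D i ω))) =
      (Measure.pi fun _ : J => PD).prod (Measure.pi fun _ : I => PD) := by
  have hlaw : ∀ S : Finset ℕ, P.map (fun ω (i : S) => D i ω) = Measure.pi fun _ : S => PD := by
    intro S
    have h1 : iIndepFun (fun i : S => D i) P := hD_indep.precomp Subtype.val_injective
    rw [(iIndepFun_iff_map_fun_eq_pi_map fun i : S => (hD_meas i).aemeasurable).1 h1]
    simp only [hD_law]
  have h2 := hD_indep.indepFun_finset J I hJI hD_meas
  rw [(indepFun_iff_map_prod_eq_prod_map_map (by fun_prop) (by fun_prop)).1 h2, hlaw, hlaw]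

lemma measurableSet_trainSet_eq {K : ℕ} (N : ℕ) (k : Fin K) (J : Finset ℕ) :
    MeasurableSet {κ : ℕ → Fin K | trainSet N κ k = J} := by
  have : {κ : ℕ → Fin K | trainSet N κ k = J} =
      ⋂ i : ℕ, (fun κ : ℕ → Fin K => κ i) ⁻¹' {m | (i ∈ Finset.range N ∧ m ≠ k) ↔ i ∈ J} := by
    ext κ
    simp [trainSet, Finset.ext_iff]
  rw [this]
  exact MeasurableSet.iInter fun i => measurable_pi_apply i (MeasurableSet.of_discrete)

variable {Ω 𝒟 Ξ : Type*} [MeasurableSpace Ω] [MeasurableSpace 𝒟] {d L K : ℕ}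

/-- The supremum over `t ∈ T` and over the coordinates of the centred sums over the sample `y` of
the moments at the nuisance function `ξ`. -/
noncomputable def foldDeviation (PD : Measure 𝒟) (g : 𝒟 → Rn d → Ξ → Rn L) (T : Set (Rn d))
    (ξ : Rn d → Ξ) {I : Finset ℕ} (y : I → 𝒟) : ℝ≥0∞ :=
  ⨆ i : T × Fin L, ‖∑ k, g (y k) i.1 (ξ i.1) i.2
    - Fintype.card I * ∫ x, g x i.1 (ξ i.1) i.2 ∂PD‖ₑ

/-- Joint measurability in training and test sample is what the conditional Markov inequality needs.
Restricting the supremum to a countable `T` makes it available. -/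
lemma measurable_foldDeviation {PD : Measure 𝒟} [SFinite PD] {g : 𝒟 → Rn d → Ξ → Rn L}
    {est : (N : ℕ) → (J : Finset ℕ) → (J → 𝒟) → Rn d → Ξ} {Θ T : Set (Rn d)}
    (hest : ∀ N (J : Finset ℕ), ∀ θ ∈ Θ,
      Measurable (fun p : (J → 𝒟) × 𝒟 => g p.2 θ (est N J p.1 θ)))
    (hT : T ⊆ Θ) (hTc : T.Countable) (N : ℕ) (J I : Finset ℕ) :
    Measurable fun q : (J → 𝒟) × (I → 𝒟) => foldDeviation PD g T (est N J q.1) q.2 := by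
  have := hTc.to_subtype
  refine Measurable.iSup fun i => ?_
  have h1 : Measurable fun p : (J → 𝒟) × 𝒟 => g p.2 i.1 (est N J p.1 i.1) i.2 := by
    exact (PiLp.continuous_apply 2 (fun _ : Fin L => ℝ) i.2).measurable.comp
      (hest N J i.1 (hT i.1.2))
  have h2 : Measurable fun p : J → 𝒟 => ∫ x, g x i.1 (est N J p i.1) i.2 ∂PD :=
    (h1.stronglyMeasurable.integral_prod_right' (ν := PD)).measurable
  have h3 : ∀ k : I, Measurable fun q : (J → 𝒟) × (I → 𝒟) =>
      g (q.2 k) i.1 (est N J q.1 i.1) i.2 := fun k =>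
    h1.comp (measurable_fst.prodMk ((measurable_pi_apply k).comp measurable_snd))
  have h4 : Measurable fun q : (J → 𝒟) × (I → 𝒟) =>
      ∫ x, g x i.1 (est N J q.1 i.1) i.2 ∂PD := h2.comp measurable_fst
  refine Measurable.enorm ((Finset.measurable_fun_sum _ fun k _ => h3 k).sub ?_)
  exact h4.const_mul _

lemma lintegral_foldDeviation_le {PD : Measure 𝒟} [IsProbabilityMeasure PD]
    {g : 𝒟 → Rn d → Ξ → Rn L} {Θ T : Set (Rn d)} (hT : T ⊆ Θ) (hTc : T.Countable) {ξ : Rn d → Ξ}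
    (hmeas : ∀ θ ∈ Θ, Measurable (fun x => g x θ (ξ θ))) {F : 𝒟 → ℝ} (hFm : Measurable F)
    (hF : ∀ᵐ x ∂PD, ∀ θ ∈ Θ, ∀ l, |g x θ (ξ θ) l| ≤ F x) (hF2 : MemLp F 2 PD) {a v : ℝ}
    (hent : UniformEntropyBound (momentClass g Θ ξ) F a v) (I : Finset ℕ) :
    ∫⁻ y : I → 𝒟, foldDeviation PD g T ξ y ∂Measure.pi (fun _ => PD) ≤
      ENNReal.ofReal (2 * entropyConst a v) * (ENNReal.ofReal √(I.card) * eLpNorm F 2 PD) := by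
  have := hTc.to_subtype
  have h := lintegral_iSup_empirical_le (I := I) PD hent hF2 hFm
    (fun (i : T × Fin L) x => g x i.1 (ξ i.1) i.2)
    (fun i => ⟨i.1, hT i.1.2, i.2, rfl⟩)
    (fun i => (PiLp.continuous_apply 2 (fun _ : Fin L => ℝ) i.2).measurable.comp
      (hmeas i.1 (hT i.1.2)))
    (hF.mono fun x hx i => hx i.1 (hT i.1.2) i.2)
  simpa [foldDeviation] using h

/-- Pointwise measurability passes from `T` to `Θ`: along the approximating sequence the sample
values converge, and the means converge by dominated convergence under the envelope. -/
lemma enorm_le_foldDeviation {PD : Measure 𝒟} {g : 𝒟 → Rn d → Ξ → Rn L} {Θ T : Set (Rn d)}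
    (hT : T ⊆ Θ) {ξ : Rn d → Ξ}
    (hmeas : ∀ θ ∈ Θ, Measurable (fun x => g x θ (ξ θ))) {F : 𝒟 → ℝ}
    (hF : ∀ᵐ x ∂PD, ∀ θ ∈ Θ, ∀ l, |g x θ (ξ θ) l| ≤ F x) (hFi : Integrable F PD)
    (hpt : ∀ θ ∈ Θ, ∃ t : ℕ → Rn d, (∀ j, t j ∈ T) ∧
      ∀ x, Tendsto (fun j => g x (t j) (ξ (t j))) atTop (𝓝 (g x θ (ξ θ))))
    {I : Finset ℕ} (y : I → 𝒟) {θ : Rn d} (hθ : θ ∈ Θ) (l : Fin L) :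
    ‖∑ k, g (y k) θ (ξ θ) l - Fintype.card I * ∫ x, g x θ (ξ θ) l ∂PD‖ₑ ≤
      foldDeviation PD g T ξ y := by
  obtain ⟨t, htT, ht⟩ := hpt θ hθ
  have hl : ∀ x, Tendsto (fun j => g x (t j) (ξ (t j)) l) atTop (𝓝 (g x θ (ξ θ) l)) := fun x =>
    ((PiLp.continuous_apply 2 (fun _ : Fin L => ℝ) l).tendsto _).comp (ht x)
  have hint : Tendsto (fun j => ∫ x, g x (t j) (ξ (t j)) l ∂PD) atTop
      (𝓝 (∫ x, g x θ (ξ θ) l ∂PD)) := by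
    refine tendsto_integral_of_dominated_convergence F (fun j => ?_) hFi (fun j => ?_)
      (Eventually.of_forall hl)
    · exact ((PiLp.continuous_apply 2 (fun _ : Fin L => ℝ) l).measurable.comp
        (hmeas (t j) (hT (htT j)))).aestronglyMeasurable
    · exact hF.mono fun x hx => hx (t j) (hT (htT j)) l
  have hlim := ((tendsto_finsetSum Finset.univ fun k _ => hl (y k)).sub
    (hint.const_mul (Fintype.card I : ℝ))).enorm
  refine le_of_tendsto' hlim fun j => ?_
  exact le_iSup (fun i : T × Fin L => ‖∑ k, g (y k) i.1 (ξ i.1) i.2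
    - Fintype.card I * ∫ x, g x i.1 (ξ i.1) i.2 ∂PD‖ₑ) (⟨t j, htT j⟩, l)

/-- The deviations of the fold averages from their conditional means are of the order `1 / √N`. -/
theorem exists_measure_fold_deviation_le
    {P : Measure Ω} [IsProbabilityMeasure P] {PD : Measure 𝒟} [IsProbabilityMeasure PD]
    {D : ℕ → Ω → 𝒟} (hD_meas : ∀ i, Measurable (D i)) (hD_indep : iIndepFun D P)
    (hD_law : ∀ i, P.map (D i) = PD)
    {g : 𝒟 → Rn d → Ξ → Rn L} {ξ₀ : Rn d → Ξ} {Θ : Set (Rn d)}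
    {fold : ℕ → Ω → ℕ → Fin K} (h_fold : IsRandomPartition P D fold)
    {est : (N : ℕ) → (J : Finset ℕ) → (J → 𝒟) → Rn d → Ξ} {ΞN : ℕ → Set (Rn d → Ξ)}
    (h_reg : RegularityCondition PD g ξ₀ Θ ΞN) (h_smeas : SuitablyMeasurable g Θ ΞN est) :
    ∃ C₀ : ℝ, 0 ≤ C₀ ∧ ∀ N ≥ 1, ∀ k : Fin K, ∀ M : ℝ, 0 < M →
      P {ω | foldEstimate est D fold N k ω ∈ ΞN N ∧ ∃ θ ∈ Θ, ∃ l,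
        M * √N < |∑ i ∈ Finset.range N \ trainSet N (fold N ω) k,
            g (D i ω) θ (foldEstimate est D fold N k ω θ) l -
          (Finset.range N \ trainSet N (fold N ω) k).card *
            ∫ x, g x θ (foldEstimate est D fold N k ω θ) l ∂PD|} ≤ ENNReal.ofReal (C₀ / M) := by
  obtain ⟨c, hc, c₁, a, v, henv⟩ := h_reg.envelope_entropy
  refine ⟨2 * entropyConst a v * max c₁ 0,
    mul_nonneg (mul_nonneg zero_le_two (entropyConst_nonneg a v)) (le_max_right _ _), ?_⟩
  intro N hN k M hM
  set C₀ : ℝ := 2 * entropyConst a v * max c₁ 0 with hC₀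
  have hC₀0 : 0 ≤ C₀ :=
    mul_nonneg (mul_nonneg zero_le_two (entropyConst_nonneg a v)) (le_max_right _ _)
  have hNpos : (0 : ℝ) < √N := Real.sqrt_pos.2 (by exact_mod_cast hN)
  obtain ⟨T, hT, hTc, hpt⟩ := h_smeas.pointwise N hN
  set t : ℝ≥0∞ := ENNReal.ofReal (M * √N) with ht
  set b : ℝ≥0∞ := ENNReal.ofReal (C₀ * √N) with hb
  -- `ΞN N` carries no measurable structure, so membership of the estimate in it is replaced by a
  -- measurable consequence: the bound `b` on the conditional mean.
  let S : ∀ J : Finset ℕ, Set ((J → 𝒟) × ((Finset.range N \ J : Finset ℕ) → 𝒟)) := fun J =>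
    {q | ∫⁻ y : (Finset.range N \ J : Finset ℕ) → 𝒟, foldDeviation PD g T (est N J q.1) y
        ∂Measure.pi (fun _ => PD) ≤ b ∧
      t < foldDeviation PD g T (est N J q.1) q.2}
  have hS : ∀ J, MeasurableSet (S J) ∧
      ((Measure.pi fun _ => PD).prod (Measure.pi fun _ => PD)) (S J) ≤ b / t := fun J =>
    prod_measure_conditional_markov _ _
      (measurable_foldDeviation (PD := PD) h_smeas.estimated hT hTc N J (Finset.range N \ J)) b t
      (by simp only [ht, ne_eq, ENNReal.ofReal_eq_zero, not_le]; positivity) (by simp [ht])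
  have hbt : b / t = ENNReal.ofReal (C₀ / M) := by
    rw [hb, ht, ← ENNReal.ofReal_div_of_pos (by positivity)]
    congr 1
    field_simp
  rw [← hbt]
  let A : Finset ℕ → Set Ω := fun J => {ω | trainSet N (fold N ω) k = J}
  let B : Finset ℕ → Set Ω := fun J =>
    (fun ω => ((fun i : J => D i ω), (fun i : (Finset.range N \ J : Finset ℕ) => D i ω))) ⁻¹' S J
  have hA : ∀ J, MeasurableSet (A J) := fun J =>
    h_fold.measurable N (measurableSet_trainSet_eq N k J)
  have hB : ∀ J, P (B J) ≤ b / t := by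
    intro J
    have hm : Measurable fun ω =>
      ((fun i : J => D i ω), (fun i : (Finset.range N \ J : Finset ℕ) => D i ω)) := by fun_prop
    rw [← Measure.map_apply hm (hS J).1,
      map_restrict_pair_eq_prod hD_meas hD_indep hD_law Finset.disjoint_sdiff]
    exact (hS J).2
  -- The partition is independent of the data, so fixing the training set does not change the law of
  -- the observations.
  have hAB : ∀ J, P (A J ∩ B J) = P (A J) * P (B J) := by
    intro J
    have hm : Measurable fun z : ℕ → 𝒟 =>
      ((fun i : J => z i), (fun i : (Finset.range N \ J : Finset ℕ) => z i)) := by fun_prop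
    exact (h_fold.indep N).measure_inter_preimage_eq_mul _ _ (measurableSet_trainSet_eq N k J)
      (hm (hS J).1)
  have hsub : {ω | foldEstimate est D fold N k ω ∈ ΞN N ∧ ∃ θ ∈ Θ, ∃ l,
        M * √N < |∑ i ∈ Finset.range N \ trainSet N (fold N ω) k,
            g (D i ω) θ (foldEstimate est D fold N k ω θ) l -
          (Finset.range N \ trainSet N (fold N ω) k).card *
            ∫ x, g x θ (foldEstimate est D fold N k ω θ) l ∂PD|} ⊆
      ⋃ J ∈ (Finset.range N).powerset, A J ∩ B J := by
    rintro ω ⟨hmem, θ, hθ, l, hlt⟩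
    refine Set.mem_biUnion (Finset.mem_coe.2 (Finset.mem_powerset.2 (Finset.filter_subset
      (fun i => fold N ω i ≠ k) (Finset.range N)))) ⟨rfl, ?_⟩
    obtain ⟨F, hFm, hF, hFc, hent⟩ := henv N hN _ hmem
    have h2c : eLpNorm F 2 PD ≤ ENNReal.ofReal (max c₁ 0) := by
      refine (eLpNorm_le_eLpNorm_of_exponent_le ?_ hFm.aestronglyMeasurable).trans
        (hFc.trans (ENNReal.ofReal_le_ofReal (le_max_left _ _)))
      rw [show (2 : ℝ≥0∞) = ENNReal.ofReal 2 by simp]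
      exact ENNReal.ofReal_le_ofReal hc.le
    have hF2 : MemLp F 2 PD := ⟨hFm.aestronglyMeasurable, h2c.trans_lt ENNReal.ofReal_lt_top⟩
    have hmeas := h_smeas.moment N hN _ hmem
    refine ⟨?_, ?_⟩
    · refine (lintegral_foldDeviation_le hT hTc hmeas hFm hF hF2 hent _).trans ?_
      have hcard : ((Finset.range N \ trainSet N (fold N ω) k).card : ℝ) ≤ N := by
        have := Finset.card_le_card
          (Finset.sdiff_subset (s := Finset.range N) (t := trainSet N (fold N ω) k))
        rw [Finset.card_range] at this
        exact_mod_cast this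
      calc _ ≤ ENNReal.ofReal (2 * entropyConst a v) *
            (ENNReal.ofReal √N * ENNReal.ofReal (max c₁ 0)) :=
          mul_le_mul_right (mul_le_mul' (ENNReal.ofReal_le_ofReal (Real.sqrt_le_sqrt hcard)) h2c) _
        _ = b := by
          have := entropyConst_nonneg a v
          rw [hb, hC₀, ← ENNReal.ofReal_mul (by positivity), ← ENNReal.ofReal_mul (by positivity)]
          congr 1
          ring
    · have h1 := enorm_le_foldDeviation hT hmeas hF (hF2.integrable (by norm_num))
        (hpt _ hmem) (fun i : (Finset.range N \ trainSet N (fold N ω) k : Finset ℕ) => D i ω) hθ l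
      refine lt_of_lt_of_le ?_ h1
      rw [Real.enorm_eq_ofReal_abs, ht]
      refine (ENNReal.ofReal_lt_ofReal_iff_of_nonneg (by positivity)).2 ?_
      rw [Fintype.card_coe, Finset.sum_coe_sort (Finset.range N \ trainSet N (fold N ω) k)
        (fun i => g (D i ω) θ (foldEstimate est D fold N k ω θ) l)]
      exact hlt
  calc _ ≤ P (⋃ J ∈ (Finset.range N).powerset, A J ∩ B J) := measure_mono hsub
    _ ≤ ∑ J ∈ (Finset.range N).powerset, P (A J ∩ B J) := measure_biUnion_finset_le _ _
    _ ≤ ∑ J ∈ (Finset.range N).powerset, P (A J) * (b / t) := by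
        refine Finset.sum_le_sum fun J _ => ?_
        rw [hAB]
        gcongr
        exact hB J
    -- The events `A J` are disjoint, so summing over the many possible training sets costs no
    -- factor.
    _ = P (⋃ J ∈ (Finset.range N).powerset, A J) * (b / t) := by
        rw [← Finset.sum_mul, measure_biUnion_finset _ fun J _ => hA J]
        intro J _ J' _ hne
        exact Set.disjoint_left.2 fun ω h h' => hne (Eq.trans (Eq.symm h) h')
    _ ≤ 1 * (b / t) := by gcongr; exact prob_le_one
    _ = b / t := one_mul _

end Folds

/-! ### Bias, identification and the contour level -/

section Conclusion

/-- A path with vanishing derivative at `0` and second derivative bounded by `s` on `[0, 1)` moves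
by at most `s`. -/
lemma norm_sub_le_of_second_derivWithin_le {E : Type*} [NormedAddCommGroup E] [NormedSpace ℝ E]
    {h : ℝ → E} {s : ℝ} (hc : ContinuousOn h (Set.Icc 0 1))
    (hd : DifferentiableOn ℝ h (Set.Ico 0 1)) (h0 : derivWithin h (Set.Ico 0 1) 0 = 0)
    (hd2 : DifferentiableOn ℝ (derivWithin h (Set.Ico 0 1)) (Set.Ico 0 1))
    (hs : ∀ r ∈ Set.Ico (0 : ℝ) 1, ‖derivWithin (derivWithin h (Set.Ico 0 1)) (Set.Ico 0 1) r‖ ≤ s) :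
    ‖h 1 - h 0‖ ≤ s := by
  have hz : (0 : ℝ) ∈ Set.Ico (0 : ℝ) 1 := by simp
  have hs0 : 0 ≤ s := (norm_nonneg _).trans (hs 0 hz)
  have h1 : ∀ r ∈ Set.Ico (0 : ℝ) 1, ‖derivWithin h (Set.Ico 0 1) r‖ ≤ s := by
    intro r hr
    have := (convex_Ico (0 : ℝ) 1).norm_image_sub_le_of_norm_derivWithin_le hd2 hs hz hr
    rw [h0, sub_zero, sub_zero, Real.norm_eq_abs, abs_of_nonneg hr.1] at this
    exact this.trans (mul_le_of_le_one_right hs0 hr.2.le)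
  have h2 : ∀ r ∈ Set.Ico (0 : ℝ) 1, ‖h r - h 0‖ ≤ s := by
    intro r hr
    have := (convex_Ico (0 : ℝ) 1).norm_image_sub_le_of_norm_derivWithin_le hd h1 hz hr
    rw [sub_zero, Real.norm_eq_abs, abs_of_nonneg hr.1] at this
    exact this.trans (mul_le_of_le_one_right hs0 hr.2.le)
  -- Derivatives are controlled only on `[0, 1)`; the endpoint `1` is reached by continuity.
  have hne : (𝓝[Set.Ico (0 : ℝ) 1] 1).NeBot := by
    rw [← mem_closure_iff_nhdsWithin_neBot, closure_Ico zero_ne_one]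
    simp
  have hlim : Tendsto (fun r => ‖h r - h 0‖) (𝓝[Set.Ico (0 : ℝ) 1] 1) (𝓝 ‖h 1 - h 0‖) :=
    (((hc 1 (by simp)).mono Set.Ico_subset_Icc_self).sub_const _).norm
  exact le_of_tendsto hlim (eventually_nhdsWithin_of_forall h2)

lemma norm_le_sqrt_card_mul {L : ℕ} (x : Rn L) {B : ℝ} (hB : 0 ≤ B) (h : ∀ l, |x l| ≤ B) :
    ‖x‖ ≤ √L * B := by
  rw [EuclideanSpace.norm_eq]
  refine Real.sqrt_le_iff.2 ⟨by positivity, ?_⟩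
  rw [mul_pow, Real.sq_sqrt (Nat.cast_nonneg L)]
  have h1 : ∀ l ∈ Finset.univ, ‖x l‖ ^ 2 ≤ B ^ 2 := fun l _ =>
    pow_le_pow_left₀ (norm_nonneg _) (h l) 2
  simpa using Finset.sum_le_sum h1

/-- The positive part is 1-Lipschitz in each coordinate, hence in the Euclidean norm. -/
lemma plusNorm_le_add {L : ℕ} (x y : Rn L) : plusNorm x ≤ plusNorm y + ‖y - x‖ := by
  have h : ‖(WithLp.toLp 2 (fun l => max (x l) 0) : Rn L) -
      WithLp.toLp 2 (fun l => max (y l) 0)‖ ≤ ‖y - x‖ := by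
    rw [EuclideanSpace.norm_eq, EuclideanSpace.norm_eq]
    refine Real.sqrt_le_sqrt (Finset.sum_le_sum fun l _ => ?_)
    refine pow_le_pow_left₀ (norm_nonneg _) ?_ 2
    rw [Real.norm_eq_abs, Real.norm_eq_abs]
    simp only [PiLp.sub_apply]
    rw [abs_sub_comm (y l)]
    exact abs_max_sub_max_le_abs _ _ _
  have h2 := norm_le_norm_add_norm_sub' (WithLp.toLp 2 (fun l => max (x l) 0) : Rn L)
    (WithLp.toLp 2 (fun l => max (y l) 0))
  exact h2.trans (add_le_add_right h _)

variable {𝒟 Ξ : Type*} [MeasurableSpace 𝒟] {d L K : ℕ} {PD : Measure 𝒟}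

lemma popMoment_apply {g : 𝒟 → Rn d → Ξ → Rn L} {ξ : Rn d → Ξ} {θ : Rn d}
    (hi : Integrable (fun x => g x θ (ξ θ)) PD) (l : Fin L) :
    popMoment PD g ξ θ l = ∫ x, g x θ (ξ θ) l ∂PD :=
  ((EuclideanSpace.proj l : Rn L →L[ℝ] ℝ).integral_comp_comm hi).symm

/-- The bias from the first stage is of second order. -/
lemma norm_popMoment_sub_le [SeminormedAddCommGroup Ξ] [NormedSpace ℝ Ξ]
    {g : 𝒟 → Rn d → Ξ → Rn L} {ξ₀ : Rn d → Ξ} {Θ : Set (Rn d)} {S : Set (Rn d → Ξ)} {s : ℝ}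
    (h1 : NeymanOrthogonal PD g ξ₀ Θ S) (h2 : SecondGateauxBound PD g ξ₀ Θ S s)
    {ξ : Rn d → Ξ} (hξ : ξ ∈ S) {θ : Rn d} (hθ : θ ∈ Θ) :
    ‖popMoment PD g ξ θ - popMoment PD g ξ₀ θ‖ ≤ s := by
  obtain ⟨-, hc, hd, h0⟩ := h1 ξ hξ θ hθ
  obtain ⟨hd2, hs⟩ := h2 ξ hξ θ hθ
  simpa [momentPath, popMoment] using norm_sub_le_of_second_derivWithin_le hc hd h0 hd2 hs

/-- The cross-fitted sample moment is close to the true one if its fold sums concentrate. -/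
lemma norm_sample_moment_sub_le {g : 𝒟 → Rn d → Ξ → Rn L} {ξ₀ : Rn d → Ξ} {N : ℕ} (hN : 1 ≤ N)
    (κ : ℕ → Fin K) (ξ : Fin K → Rn d → Ξ) (y : ℕ → 𝒟) (θ : Rn d) {B s : ℝ} (hB : 0 ≤ B)
    (hs : 0 ≤ s)
    (h1 : ∀ k l, |∑ i ∈ Finset.range N \ trainSet N κ k, g (y i) θ (ξ k θ) l -
      (Finset.range N \ trainSet N κ k).card * popMoment PD g (ξ k) θ l| ≤ B)
    (h2 : ∀ k, ‖popMoment PD g (ξ k) θ - popMoment PD g ξ₀ θ‖ ≤ s) :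
    ‖(N : ℝ)⁻¹ • ∑ i ∈ Finset.range N, g (y i) θ (ξ (κ i) θ) - popMoment PD g ξ₀ θ‖ ≤
      √L * (K * B / N + s) := by
  have hNpos : (0 : ℝ) < N := by exact_mod_cast hN
  refine norm_le_sqrt_card_mul _ (by positivity) fun l => ?_
  have htest : ∀ k, Finset.range N \ trainSet N κ k =
      (Finset.range N).filter (fun i => κ i = k) := by
    intro k
    ext i
    simp only [trainSet, Finset.mem_sdiff, Finset.mem_filter]
    tauto
  simp only [htest] at h1
  have hsum : ∑ i ∈ Finset.range N, g (y i) θ (ξ (κ i) θ) l =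
      ∑ k, ∑ i ∈ (Finset.range N).filter (fun i => κ i = k), g (y i) θ (ξ k θ) l := by
    rw [← Finset.sum_fiberwise (Finset.range N) κ]
    refine Finset.sum_congr rfl fun k _ => Finset.sum_congr rfl fun i hi => ?_
    rw [(Finset.mem_filter.1 hi).2]
  have hcard : ∑ k, (((Finset.range N).filter (fun i => κ i = k)).card : ℝ) = N := by
    have := Finset.card_eq_sum_card_fiberwise (f := κ) (s := Finset.range N)
      (t := Finset.univ) (fun _ _ => Finset.mem_coe.2 (Finset.mem_univ _))
    rw [Finset.card_range] at this
    exact_mod_cast this.symm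
  -- Noise plus bias, each weighted by fold size; the sizes sum to `N`, so the bias contributes at
  -- most `N * s`.
  have hdecomp : (N : ℝ) * (((N : ℝ)⁻¹ • ∑ i ∈ Finset.range N, g (y i) θ (ξ (κ i) θ) -
      popMoment PD g ξ₀ θ) l) =
      ∑ k, (∑ i ∈ (Finset.range N).filter (fun i => κ i = k), g (y i) θ (ξ k θ) l -
        ((Finset.range N).filter (fun i => κ i = k)).card * popMoment PD g (ξ k) θ l) +
      ∑ k, (((Finset.range N).filter (fun i => κ i = k)).card : ℝ) *
        (popMoment PD g (ξ k) θ - popMoment PD g ξ₀ θ) l := by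
    simp only [PiLp.sub_apply, PiLp.smul_apply, smul_eq_mul, mul_sub, Finset.sum_sub_distrib]
    rw [← Finset.sum_mul, hcard, ← hsum, mul_inv_cancel_left₀ hNpos.ne']
    simp
  have habs : (N : ℝ) * |((N : ℝ)⁻¹ • ∑ i ∈ Finset.range N, g (y i) θ (ξ (κ i) θ) -
      popMoment PD g ξ₀ θ) l| ≤ K * B + N * s := by
    rw [← abs_of_pos hNpos, ← abs_mul, abs_of_pos hNpos, hdecomp]
    refine (abs_add_le _ _).trans (add_le_add ?_ ?_)
    · refine (Finset.abs_sum_le_sum_abs _ _).trans ?_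
      simpa using Finset.sum_le_sum fun k (_ : k ∈ Finset.univ) => h1 k l
    · refine (Finset.abs_sum_le_sum_abs _ _).trans ?_
      rw [← hcard, Finset.sum_mul]
      refine Finset.sum_le_sum fun k _ => ?_
      rw [abs_mul, Nat.abs_cast]
      gcongr
      exact (PiLp.norm_apply_le _ l).trans (h2 k)
  rw [← mul_le_mul_iff_right₀ hNpos]
  refine habs.trans (le_of_eq ?_)
  field_simp

/-- The Hausdorff distance between a contour set and the identified set it contains. -/
lemma hausdorffEDist_contourSet_le {Ω : Type*} {g : 𝒟 → Rn d → Ξ → Rn L} {ξ₀ : Rn d → Ξ}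
    {Θ : Set (Rn d)} {est : (N : ℕ) → (J : Finset ℕ) → (J → 𝒟) → Rn d → Ξ}
    {D : ℕ → Ω → 𝒟} {fold : ℕ → Ω → ℕ → Fin K} {N : ℕ} (hN : 1 ≤ N) {ω : Ω} {c : ℝ}
    (hne : (identifiedSet PD g ξ₀ Θ).Nonempty) {C δ M R : ℝ} (hC : 0 < C) (hδ : 0 < δ)
    (hM : 0 ≤ M) (hR : 0 ≤ R)
    (hpart : ∀ θ ∈ Θ, min (C * Metric.infDist θ (identifiedSet PD g ξ₀ Θ)) δ ≤
      plusNorm (popMoment PD g ξ₀ θ))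
    (hcover : ∀ θ ∈ identifiedSet PD g ξ₀ Θ, (N : ℝ) * sampleCriterion g est D fold N ω θ ≤ c)
    (hdev : ∀ θ ∈ Θ, ‖(N : ℝ)⁻¹ • ∑ i ∈ Finset.range N,
      g (D i ω) θ (foldEstimate est D fold N (fold N ω i) ω θ) - popMoment PD g ξ₀ θ‖ ≤ M / √N)
    (hsmall : (∀ θ ∈ Θ, Metric.infDist θ (identifiedSet PD g ξ₀ Θ) ≤ R) ∨
      (1 + M) * √(max 1 c / N) < δ) :
    Metric.hausdorffEDist (contourSet g Θ est D fold N ω c) (identifiedSet PD g ξ₀ Θ) ≤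
      ENNReal.ofReal ((1 + M) * (1 / C + R / δ) * √(max 1 c / N)) := by
  have hNpos : (0 : ℝ) < N := by exact_mod_cast hN
  set ρ := √(max 1 c / N) with hρ
  have hρ0 : 0 ≤ ρ := Real.sqrt_nonneg _
  refine Metric.hausdorffEDist_le_of_infEDist (fun θ hθ => ?_) (fun θ hθ => ?_)
  · obtain ⟨hθΘ, hθc⟩ := hθ
    have h1 : plusNorm ((N : ℝ)⁻¹ • ∑ i ∈ Finset.range N,
        g (D i ω) θ (foldEstimate est D fold N (fold N ω i) ω θ)) ≤ ρ := by
      refine Real.le_sqrt_of_sq_le ?_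
      rw [le_div_iff₀ hNpos, mul_comm]
      exact hθc.trans (le_max_right _ _)
    -- The `1` in `1 ∨ ĉ` is used here: the rate never falls below `1 / √N`.
    have h2 : M / √N ≤ M * ρ := by
      rw [div_eq_mul_inv, ← Real.sqrt_inv]
      refine mul_le_mul_of_nonneg_left (Real.sqrt_le_sqrt ?_) hM
      rw [inv_eq_one_div]
      gcongr
      exact le_max_left _ _
    have h3 := plusNorm_le_add (popMoment PD g ξ₀ θ) ((N : ℝ)⁻¹ • ∑ i ∈ Finset.range N,
        g (D i ω) θ (foldEstimate est D fold N (fold N ω i) ω θ))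
    have h4 : min (C * Metric.infDist θ (identifiedSet PD g ξ₀ Θ)) δ ≤ (1 + M) * ρ := by
      linarith [hpart θ hθΘ, hdev θ hθΘ]
    have h5 : Metric.infDist θ (identifiedSet PD g ξ₀ Θ) ≤ (1 + M) * (1 / C + R / δ) * ρ := by
      have hexp : (1 + M) * (1 / C + R / δ) * ρ = (1 + M) * ρ / C + R * ((1 + M) * ρ / δ) := by
        field_simp
      rw [hexp]
      have hp1 : 0 ≤ (1 + M) * ρ / C := by positivity
      have hp2 : 0 ≤ R * ((1 + M) * ρ / δ) := by positivity
      -- If the truncation `δ` is active, then `(1 + M) * ρ / δ ≥ 1`. Either the distance is at most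
      -- `R` and the term in `R / δ` absorbs it, or `ρ` is too small for this to happen.
      rcases min_le_iff.1 h4 with h | h
      · have : Metric.infDist θ (identifiedSet PD g ξ₀ Θ) ≤ (1 + M) * ρ / C := by
          rw [le_div_iff₀ hC, mul_comm]
          exact h
        linarith
      · rcases hsmall with hb | hb
        · have : R ≤ R * ((1 + M) * ρ / δ) :=
            le_mul_of_one_le_right hR ((one_le_div hδ).2 h)
          linarith [hb θ hθΘ]
        · exact absurd h (not_le.2 hb)
    rw [← ENNReal.ofReal_toReal (Metric.infEDist_ne_top hne)]
    exact ENNReal.ofReal_le_ofReal h5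
  · have : θ ∈ contourSet g Θ est D fold N ω c := ⟨hθ.1, hcover θ hθ⟩
    rw [Metric.infEDist_zero_of_mem this]
    exact zero_le

/-- In the unbounded case the level is eventually small compared with the sample size. -/
lemma eventually_measure_level_le {Ω : Type*} [MeasurableSpace Ω] {P : Measure Ω}
    {chat : ℕ → Ω → ℝ}
    (h : TendstoInMeasure P (fun N ω => chat N ω / N) atTop (fun _ => (0 : ℝ)))
    {η : ℝ} (hη : 0 < η) {ε : ℝ≥0∞} (hε : 0 < ε) :
    ∀ᶠ N : ℕ in atTop, P {ω | η ≤ √(max 1 (chat N ω) / N)} ≤ ε := by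
  have h1 := (tendstoInMeasure_iff_dist.1 h (η ^ 2) (by positivity)).eventually (Iic_mem_nhds hε)
  have h2 : ∀ᶠ N : ℕ in atTop, 1 / (N : ℝ) < η ^ 2 :=
    tendsto_one_div_atTop_nhds_zero_nat.eventually (gt_mem_nhds (by positivity))
  filter_upwards [h1, h2, eventually_ge_atTop 1] with N h1 h2 hN
  refine (measure_mono fun ω hω => ?_).trans h1
  have hNpos : (0 : ℝ) < N := by exact_mod_cast hN
  have h3 : η ^ 2 ≤ max 1 (chat N ω) / N := by
    have : (0 : ℝ) < max 1 (chat N ω) := lt_max_of_lt_left one_pos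
    exact (Real.le_sqrt (by positivity) (by positivity)).1 hω
  change η ^ 2 ≤ dist (chat N ω / N) 0
  rw [dist_zero_right, Real.norm_eq_abs]
  -- For large `N` the value `1` is too small to make the maximum exceed `η ^ 2 * N`, so the level
  -- itself must.
  rcases max_choice 1 (chat N ω) with hm | hm <;> rw [hm] at h3
  · exact absurd h3 (not_le.2 h2)
  · exact h3.trans (le_abs_self _)

lemma measure_iUnion_fin_le {Ω : Type*} [MeasurableSpace Ω] {P : Measure Ω} {A : Fin K → Set Ω}
    {b : ℝ} (h : ∀ k, P (A k) ≤ ENNReal.ofReal b) : P (⋃ k, A k) ≤ ENNReal.ofReal (K * b) := by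
  refine (measure_iUnion_fintype_le _ _).trans ((Finset.sum_le_sum fun k _ => h k).trans ?_)
  simp [ENNReal.ofReal_mul]

end Conclusion

/-! ### Assembly: four exceptional events of probability at most `ε / 4` each -/

theorem theorem1 {Ω 𝒟 Ξ : Type*} [MeasurableSpace Ω] [MeasurableSpace 𝒟]
    [SeminormedAddCommGroup Ξ] [NormedSpace ℝ Ξ] {d L K : ℕ}
    (P : Measure Ω) [IsProbabilityMeasure P] (PD : Measure 𝒟)
    -- the random sample
    (D : ℕ → Ω → 𝒟) (hD_meas : ∀ i, Measurable (D i)) (hD_indep : iIndepFun D P)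
    (hD_law : ∀ i, P.map (D i) = PD)
    -- the moment problem
    (g : 𝒟 → Rn d → Ξ → Rn L) (ξ₀ : Rn d → Ξ) (Θ : Set (Rn d))
    (h_nonempty : (identifiedSet PD g ξ₀ Θ).Nonempty)
    (h_partid : PartialIdentification PD g ξ₀ Θ)
    -- cross-fitting with `K` folds
    (fold : ℕ → Ω → ℕ → Fin K) (h_fold : IsRandomPartition P D fold)
    (est : (N : ℕ) → (J : Finset ℕ) → (J → 𝒟) → Rn d → Ξ)
    -- orthogonality, regularity and Donsker conditions
    (ΞΘ : Rn d → Set Ξ) (ΞN : ℕ → Set (Rn d → Ξ))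
    (h_orth : OrthogonalityCondition P PD g ξ₀ Θ ΞΘ ΞN est D fold)
    (h_reg : RegularityCondition PD g ξ₀ Θ ΞN)
    (h_smeas : SuitablyMeasurable g Θ ΞN est)
    (h_donsker : DonskerProperty P PD g ξ₀ Θ D)
    -- the contour level, which may depend on the data
    (chat : ℕ → Ω → ℝ)
    (h_level : Bornology.IsBounded Θ ∨
      TendstoInMeasure P (fun N ω => chat N ω / N) atTop (fun _ => (0 : ℝ)))
    (h_cover : WithProbTendingToOne P (fun N => {ω | ∀ θ ∈ identifiedSet PD g ξ₀ Θ,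
      (N : ℝ) * sampleCriterion g est D fold N ω θ ≤ chat N ω})) :
    IsBigOP P
      (fun N ω => Metric.hausdorffEDist (contourSet g Θ est D fold N ω (chat N ω))
        (identifiedSet PD g ξ₀ Θ))
      (fun N ω => √(max 1 (chat N ω) / N)) := by
  have hPD : IsProbabilityMeasure PD := by
    rw [← hD_law 0]
    exact Measure.isProbabilityMeasure_map (hD_meas 0).aemeasurable
  obtain ⟨C, hC, δ, hδ, hpart⟩ := h_partid
  obtain ⟨C₀, hC₀, hfold⟩ :=
    exists_measure_fold_deviation_le hD_meas hD_indep hD_law h_fold h_reg h_smeas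
  obtain ⟨φ, hφ, hφP⟩ := h_orth.estimate_mem
  obtain ⟨s, hs, hsb⟩ := h_orth.second_deriv
  intro ε hε
  -- Chosen so that `K * C₀ / M ≤ ε / 4`; the `+ 1` keeps `M` positive when `K * C₀ = 0`. In `M₁`
  -- the `1` pays for the bias, eventually at most `1 / √N`.
  set M : ℝ := 4 * (K * C₀) / ε + 1 with hM
  have hM0 : 0 < M := by positivity
  set M₁ : ℝ := √L * (K * M + 1) with hM₁
  have hM₁0 : 0 ≤ M₁ := by positivity
  -- The two alternatives for the level in one form: for bounded `Θ`, `R` is the diameter and `E` is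
  -- empty; otherwise `R = 0` and `E` is the event of a large level.
  obtain ⟨R, hR, E, hE, hER⟩ : ∃ R : ℝ, 0 ≤ R ∧ ∃ E : ℕ → Set Ω,
      (∀ᶠ N in atTop, P (E N) ≤ ENNReal.ofReal (ε / 4)) ∧
      ∀ N, ∀ ω ∉ E N, (∀ θ ∈ Θ, Metric.infDist θ (identifiedSet PD g ξ₀ Θ) ≤ R) ∨
        (1 + M₁) * √(max 1 (chat N ω) / N) < δ := by
    rcases h_level with hb | hb
    · obtain ⟨θ₀, hθ₀⟩ := h_nonempty
      exact ⟨Metric.diam Θ, Metric.diam_nonneg, fun _ => ∅, by simp, fun N ω _ => Or.inl fun θ hθ =>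
        (Metric.infDist_le_dist_of_mem hθ₀).trans (Metric.dist_le_diam_of_mem hb hθ hθ₀.1)⟩
    · refine ⟨0, le_rfl, _, eventually_measure_level_le hb (η := δ / (1 + M₁)) (by positivity)
        (ENNReal.ofReal_pos.2 (by positivity)), fun N ω hω => Or.inr ?_⟩
      rw [mul_comm, ← lt_div_iff₀ (by positivity)]
      exact not_le.1 hω
  refine ⟨(1 + M₁) * (1 / C + R / δ), by positivity, ?_⟩
  have hφ' : ∀ᶠ N in atTop, K * φ N ≤ ε / 4 := by
    have : Tendsto (fun N => K * φ N) atTop (𝓝 0) := by simpa using hφ.const_mul (K : ℝ)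
    exact this.eventually (Iic_mem_nhds (by positivity))
  have hs' : ∀ᶠ N : ℕ in atTop, |s N| ≤ 1 / √N := by
    filter_upwards [hs.bound one_pos] with N h
    rw [one_mul, Real.rpow_neg (Nat.cast_nonneg N), ← Real.sqrt_eq_rpow, norm_inv,
      Real.norm_eq_abs, Real.norm_eq_abs, abs_of_nonneg (Real.sqrt_nonneg _)] at h
    rwa [one_div]
  have hcov := h_cover.eventually
    (Iic_mem_nhds (ENNReal.ofReal_pos.2 (show 0 < ε / 4 by positivity)))
  filter_upwards [hE, hφ', hs', hcov, eventually_ge_atTop 1] with N hE hφN hsN hcov hN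
  have hNpos : (0 : ℝ) < N := by exact_mod_cast hN
  set A₁ : Set Ω := ⋃ k, {ω | foldEstimate est D fold N k ω ∉ ΞN N}
  set A₂ : Set Ω := ⋃ k : Fin K, {ω | foldEstimate est D fold N k ω ∈ ΞN N ∧ ∃ θ ∈ Θ, ∃ l,
        M * √N < |∑ i ∈ Finset.range N \ trainSet N (fold N ω) k,
            g (D i ω) θ (foldEstimate est D fold N k ω θ) l -
          (Finset.range N \ trainSet N (fold N ω) k).card *
            ∫ x, g x θ (foldEstimate est D fold N k ω θ) l ∂PD|}
  set A₃ : Set Ω := {ω | ∀ θ ∈ identifiedSet PD g ξ₀ Θ,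
      (N : ℝ) * sampleCriterion g est D fold N ω θ ≤ chat N ω}ᶜ
  have hA₁ : P A₁ ≤ ENNReal.ofReal (ε / 4) :=
    (measure_iUnion_fin_le (hφP N hN)).trans (ENNReal.ofReal_le_ofReal hφN)
  have hA₂ : P A₂ ≤ ENNReal.ofReal (ε / 4) := by
    refine (measure_iUnion_fin_le fun k => hfold N hN k M hM0).trans
      (ENNReal.ofReal_le_ofReal ?_)
    rw [← mul_div_assoc, div_le_iff₀ hM0, hM, mul_add, ← mul_div_assoc]
    have : ε / 4 * (4 * (K * C₀)) / ε = K * C₀ := by field_simp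
    rw [this]
    linarith
  have hsub : {ω | ENNReal.ofReal ((1 + M₁) * (1 / C + R / δ) * √(max 1 (chat N ω) / N)) <
      Metric.hausdorffEDist (contourSet g Θ est D fold N ω (chat N ω))
        (identifiedSet PD g ξ₀ Θ)} ⊆ (A₁ ∪ A₂) ∪ (A₃ ∪ E N) := by
    intro ω hω
    by_contra hgood
    simp only [Set.mem_union, not_or] at hgood
    obtain ⟨⟨h1, h2⟩, h3, h4⟩ := hgood
    have hmem : ∀ k, foldEstimate est D fold N k ω ∈ ΞN N := by
      intro k
      by_contra h
      exact h1 (Set.mem_iUnion.2 ⟨k, h⟩)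
    have hdevk : ∀ k, ∀ θ ∈ Θ, ∀ l, |∑ i ∈ Finset.range N \ trainSet N (fold N ω) k,
          g (D i ω) θ (foldEstimate est D fold N k ω θ) l -
        (Finset.range N \ trainSet N (fold N ω) k).card *
          popMoment PD g (foldEstimate est D fold N k ω) θ l| ≤ M * √N := by
      intro k θ hθ l
      have hi : Integrable (fun x => g x θ (foldEstimate est D fold N k ω θ)) PD := by
        -- At `r = 1` the path ends at the estimate itself, so its moments are integrable.
        simpa using (h_orth.orthogonal N hN _ (hmem k) θ hθ).1 1 (by simp)
      rw [popMoment_apply hi]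
      by_contra! h
      exact h2 (Set.mem_iUnion.2 ⟨k, hmem k, θ, hθ, l, h⟩)
    have hdev : ∀ θ ∈ Θ, ‖(N : ℝ)⁻¹ • ∑ i ∈ Finset.range N,
        g (D i ω) θ (foldEstimate est D fold N (fold N ω i) ω θ) - popMoment PD g ξ₀ θ‖ ≤
          M₁ / √N := by
      intro θ hθ
      refine (norm_sample_moment_sub_le hN (fold N ω) (fun k => foldEstimate est D fold N k ω)
        (fun i => D i ω) θ (B := M * √N) (s := 1 / √N) (by positivity) (by positivity)
        (fun k l => hdevk k θ hθ l) fun k => (norm_popMoment_sub_le (h_orth.orthogonal N hN)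
          (hsb N hN) (hmem k) hθ).trans ((le_abs_self _).trans hsN)).trans (le_of_eq ?_)
      have hsq : √(N : ℝ) * √N = N := Real.mul_self_sqrt hNpos.le
      have hsp : (0 : ℝ) < √N := Real.sqrt_pos.2 hNpos
      have hKM : K * (M * √N) / N = K * M / √N := by
        rw [div_eq_div_iff hNpos.ne' hsp.ne']
        linear_combination (K * M) * hsq
      rw [hM₁, hKM]
      ring
    refine absurd (Set.mem_ofPred_eq ▸ hω) (not_lt.2 ?_)
    exact hausdorffEDist_contourSet_le hN h_nonempty hC hδ hM₁0 hR hpart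
      (not_not.1 h3) hdev (hER N ω h4)
  calc _ ≤ P ((A₁ ∪ A₂) ∪ (A₃ ∪ E N)) := measure_mono hsub
    _ ≤ (P A₁ + P A₂) + (P A₃ + P (E N)) :=
        (measure_union_le _ _).trans (add_le_add (measure_union_le _ _) (measure_union_le _ _))
    _ ≤ (ENNReal.ofReal (ε / 4) + ENNReal.ofReal (ε / 4)) +
        (ENNReal.ofReal (ε / 4) + ENNReal.ofReal (ε / 4)) :=
        add_le_add (add_le_add hA₁ hA₂) (add_le_add hcov hE)
    _ = ENNReal.ofReal ε := by
        rw [← ENNReal.ofReal_add (by positivity) (by positivity),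
          ← ENNReal.ofReal_add (by positivity) (by positivity)]
        congr 1
        ring
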